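/- Let $G:\mathbb{R}\to\mathbb{R}$ be nonpositive, even, $G\in L^1(\mathbb{R})\cap C^1(\mathbb{R})$, with a unique local (and global) minimum (located at $x=0$), and with $G(0)<-2$. Assume that $G$ is real-analytic with $G'(x)>0$ at each $x>0$, let $G^{-1}$ denote the inverse of $G|_{[0,\infty)}$, and assume that $\mathscr{G}(m):=\sqrt{m}\sqrt{G(0)^2-m}\,/\,(2G'(G^{-1}(-\sqrt{m})))$, $0<m<G(0)^2$, can be continued analytically to neighborhoods of $m=0$ and $m=G(0)^2$ with $\mathscr{G}(0)>0$ and $\mathscr{G}(G(0)^2)>0$. Put $x_{\mathrm{crit}}:=G^{-1}(-2)$, $\nu:=1/(12G'(x_{\mathrm{crit}}))$, $\Delta x:=x-x_{\mathrm{crit}}$. With principal branches, for $|\arg(-w)|<\pi$ set $E(w):=\tfrac{i}{4}[(-w)^{1/2}+(-w)^{-1/2}]$, $D(w):=\tfrac{i}{4}[(-w)^{1/2}-(-w)^{-1/2}]$, and, for $x,t\in\mathbb{R}$, $Q(w;x,t):=E(w)x+D(w)t$. Let $$\Psi(iv/4):=\tfrac12\int_0^{G^{-1}(-v)}\sqrt{G(s)^2-v^2}\,ds,\quad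 0<v\le -G(0),\qquad \theta_0(w):=\Psi(E(w)).$$ Let $\mathfrak{a}:=-\tfrac14(\sqrt{G(0)^2-4}-G(0))^2$, $\mathfrak{b}:=1/\mathfrak{a}$ (so $\mathfrak{a}<-1<\mathfrak{b}<0$), and let $P_\infty:=[\mathfrak{a},\mathfrak{b}]\cup S^1$, with $(\mathfrak{a},-1)$ and $(-1,\mathfrak{b})$ both oriented toward $-1$ and the upper and lower unit semicircles oriented from $-1$ to $1$. Off $P_\infty\cup\mathbb{R}_+$ set $$L(w):=\frac{(-w)^{1/2}}{\pi}\int_{P_\infty}\frac{\theta_0(y)}{(-y)^{1/2}}\frac{dy}{y-w},$$ $$\mathfrak{m}(w):=\frac{w}{2\pi}\int_{\mathfrak{a}}^{\mathfrak{b}}\frac{\theta_0(s)\,ds}{(-s)^{1/2}(s-w)}+\begin{cases}-\tfrac12(x+t)w,&|w|<1,\\ \tfrac12(t-x),&|w|>1,\end{cases}$$ and $\mathfrak{g}(w;x,t):=\tfrac12L(w)\pm(-w)^{-1/2}\mathfrak{m}(w)$, with the sign $+$ for $|w|>1$ and $-$ for $|w|<1$. Let $L_\pm$ be the boundary values of $L$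 on $(\mathfrak{a},-1)$ from above ($+$) and below ($-$), let $\overline{L}:=\tfrac12(L_++L_-)$, and define $$k(w;x,t):=2iQ(w;x,t)+\overline{L}(w)-2\mathfrak{g}(w;x,t),\qquad \mathfrak{a}<w<-1,$$ where $\mathfrak{g}$ is extended continuously across $(\mathfrak{a},-1)$. Then $x_{\mathrm{crit}}>0$, $G(x_{\mathrm{crit}})=-2$, $\nu>0$, and for real $w<-1$ close enough to $-1$ the above limits exist. There is a disc centered at $w=-1$, independent of $x$ and $t$, to which $k(w;x,t)$ continues analytically from $w<-1$ for all real $x,t$. All Taylor coefficients of $k(\cdot;x,t)$ at $w=-1$ are (affine) linear functions of $\Delta x$ and $t$, and $$\begin{aligned}k(w;x,t)=&-t+\tfrac12\Delta x\,(w+1)+\left[\tfrac14\Delta x-\tfrac18t\right](w+1)^2+\left[\tfrac3{16}\Delta x-\tfrac18t+\nu\right](w+1)^3\\&+\left[\tfrac5{32}\Delta x-\tfrac{15}{128}t+\tfrac32\nu\right](w+1)^4+\mathcal{O}((w+1)^5),\qquad w\to-1,\end{aligned}$$ where the error term is uniform for bounded $\Delta x$ and $t$. -/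

import Mathlib

open Filter Topology Set

noncomputable section

namespace SineGordon

/-- The inverse of `G` restricted to `[0, ∞)`; for the data considered below it is a genuine
inverse on `[G 0, 0)`. -/
def Ginv (G : ℝ → ℝ) (y : ℝ) : ℝ := Function.invFunOn G (Ici 0) y

/-- The function `𝒢(m) = √m √(G(0)² - m) / (2 G'(G⁻¹(-√m)))`, used for `0 < m < G(0)²`. -/
def scriptG (G : ℝ → ℝ) (m : ℝ) : ℝ :=
  Real.sqrt m * Real.sqrt (G 0 ^ 2 - m) / (2 * deriv G (Ginv G (-Real.sqrt m)))

/-- The standing assumptions on the initial impulse profile `G`. -/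
structure IsImpulseProfile (G : ℝ → ℝ) : Prop where
  nonpos : ∀ x, G x ≤ 0
  integrable : MeasureTheory.Integrable G
  contDiff : ContDiff ℝ 1 G
  /-- There is a unique local minimum, and it is a global one. -/
  unique_min : ∃ x₀, (∀ y, G x₀ ≤ G y) ∧ ∀ y, IsLocalMin G y → y = x₀
  even : ∀ x, G (-x) = G x
  analytic : AnalyticOnNhd ℝ G (Ioi 0)
  deriv_pos : ∀ x, 0 < x → 0 < deriv G x
  /-- `𝒢` continues analytically to neighborhoods of both endpoints of `[0, G(0)²]`, with
  positive values there. -/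
  scriptG_nice : ∃ Γ : ℝ → ℝ, AnalyticOnNhd ℝ Γ (Icc 0 (G 0 ^ 2)) ∧
    (∀ m ∈ Ioo 0 (G 0 ^ 2), Γ m = scriptG G m) ∧ 0 < Γ 0 ∧ 0 < Γ (G 0 ^ 2)
  kinks : G 0 < -2

/-- `x_crit = G⁻¹(-2)`. -/
def xcrit (G : ℝ → ℝ) : ℝ := Ginv G (-2)

/-- `ν = 1 / (12 G'(x_crit))`. -/
def nu (G : ℝ → ℝ) : ℝ := 1 / (12 * deriv G (xcrit G))

/-- `Ψ(λ) = ½ ∫₀^{G⁻¹(-v)} √(G(s)² - v²) ds` for `λ = iv/4`, `0 < v ≤ -G(0)`.  It is only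
evaluated at such purely imaginary `λ`, where `v = 4 Im λ`. -/
def Psi (G : ℝ → ℝ) (l : ℂ) : ℝ :=
  (1 / 2) * ∫ s in (0 : ℝ)..(Ginv G (-(4 * l.im))), Real.sqrt (G s ^ 2 - (4 * l.im) ^ 2)

/-- The principal branch of `(-w)^{1/2}`. -/
def rt (w : ℂ) : ℂ := (-w) ^ (1 / 2 : ℂ)

def E (w : ℂ) : ℂ := Complex.I / 4 * (rt w + (rt w)⁻¹)

def D (w : ℂ) : ℂ := Complex.I / 4 * (rt w - (rt w)⁻¹)

def Q (x t : ℝ) (w : ℂ) : ℂ := E w * x + D w * t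

/-- `θ₀(w) = Ψ(E(w))`, evaluated only on the contour `P_∞` below, where `E` is purely
imaginary. -/
def theta0 (G : ℝ → ℝ) (w : ℂ) : ℂ := (Psi G (E w) : ℂ)

def endA (G : ℝ → ℝ) : ℝ := -(1 / 4) * (Real.sqrt (G 0 ^ 2 - 4) - G 0) ^ 2

def endB (G : ℝ → ℝ) : ℝ := -(1 / 4) * (Real.sqrt (G 0 ^ 2 - 4) + G 0) ^ 2

/-- The contour `P_∞ = [𝔞, 𝔟] ∪ S¹` as a point set. -/
def PInf (G : ℝ → ℝ) : Set ℂ :=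
  Metric.sphere (0 : ℂ) 1 ∪ (fun s : ℝ => (s : ℂ)) '' Icc (endA G) (endB G)

/-- The integral over `P_∞` with its orientation: both intervals `(𝔞, -1)` and `(-1, 𝔟)` are
oriented toward `-1`, and the upper and lower unit semicircles from `-1` to `1`. -/
def intPInf (G : ℝ → ℝ) (f : ℂ → ℂ) : ℂ :=
  (∫ s in (endA G)..(-1), f (s : ℂ)) + (∫ s in (endB G)..(-1), f (s : ℂ)) +
  (∫ φ in Real.pi..0, f (Complex.exp (φ * Complex.I)) *
    (Complex.I * Complex.exp (φ * Complex.I))) +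
  (∫ φ in (-Real.pi)..0, f (Complex.exp (φ * Complex.I)) *
    (Complex.I * Complex.exp (φ * Complex.I)))

/-- The Cauchy integral `L(w)`, for `w` off `P_∞ ∪ ℝ₊`. -/
def L (G : ℝ → ℝ) (w : ℂ) : ℂ :=
  rt w / Real.pi * intPInf G (fun y => theta0 G y / rt y / (y - w))

/-- The function `𝔪(w)`, for `w` off `P_∞`. -/
def mfun (G : ℝ → ℝ) (x t : ℝ) (w : ℂ) : ℂ :=
  w / (2 * Real.pi) * (∫ s in (endA G)..(endB G), theta0 G s / (rt s * (s - w))) +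
    if ‖w‖ < 1 then -((x + t) / 2) * w else (t - x) / 2

/-- The function `𝔥(w)`, for `w` off `P_∞ ∪ ℝ₊`. -/
def hfun (G : ℝ → ℝ) (x t : ℝ) (w : ℂ) : ℂ :=
  if ‖w‖ < 1 then -((rt w)⁻¹ * mfun G x t w) else (rt w)⁻¹ * mfun G x t w

/-- The function `𝔤(w) = L(w)/2 + 𝔥(w)`, for `w` off `P_∞ ∪ ℝ₊`. -/
def gfun (G : ℝ → ℝ) (x t : ℝ) (w : ℂ) : ℂ := L G w / 2 + hfun G x t w

/-- `κ = 2iQ(w) + L̄(w) - 2𝔤(w)` at a real point `w ∈ (𝔞, -1)`.  Here `L̄ = (L₊ + L₋)/2` is the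
mean of the boundary values of `L` from the upper (left) and lower (right) half-planes, and `𝔤(w)`
is the value at `w` of the continuous extension of `𝔤` across `(𝔞, -1)`; all these limits are
required to exist. -/
def IsPhaseValue (G : ℝ → ℝ) (x t w : ℝ) (κ : ℂ) : Prop :=
  endA G < w ∧ w < -1 ∧ ∃ Lp Lm g : ℂ,
    Tendsto (L G) (𝓝[{z : ℂ | 0 < z.im}] (w : ℂ)) (𝓝 Lp) ∧
    Tendsto (L G) (𝓝[{z : ℂ | z.im < 0}] (w : ℂ)) (𝓝 Lm) ∧
    Tendsto (gfun G x t) (𝓝[(PInf G)ᶜ] (w : ℂ)) (𝓝 g) ∧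
    κ = 2 * Complex.I * Q x t w + (Lp + Lm) / 2 - 2 * g

/-- The explicit quartic Taylor polynomial, with `dx` standing for `Δx` and `z` for `w + 1`. -/
def taylorPoly (ν dx t : ℝ) (z : ℂ) : ℂ :=
  -t + (1 / 2) * dx * z + ((1 / 4) * dx - (1 / 8) * t) * z ^ 2 +
    ((3 / 16) * dx - (1 / 8) * t + ν) * z ^ 3 +
    ((5 / 32) * dx - (15 / 128) * t + (3 / 2) * ν) * z ^ 4

end SineGordon

end

/-!
On `w = -e^{2u}` one has `(-w)^{1/2} = e^u`, `E(w) = (i/2) cosh u`, `D(w) = (i/2) sinh u`, and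
`p(w) = (-w)^{1/2} - (-w)^{-1/2} = 2 sinh u`. Folding the segment `[𝔞, 𝔟]` by `s ↦ 1/s` makes its
Cauchy kernel rational in `y = 2 sinh u`. Inserting the definition of `θ₀` and exchanging the
integrals leaves, for each `s ∈ [0, x_crit]`, the elementary integral
`∫ √(m - y²) / (P - y²) dy = (π/2) (1 - (1 - m/P)^{1/2})` with `m = G(s)² - 4` and `P = p(w)²`.
Its branch cut carries the whole jump of `L` across `(𝔞, -1)`.

In `L̄ - 2𝔤` the integrals over the unit circle and over `(-1, 𝔟)` cancel, so with `p = p(w)`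
`k(w; x, t) = 2i D(w) Δx + 2i E(w) t - (1/2) ∫₀^{x_crit} √(p² - (G(s)² - 4)) ds`.
The integrand vanishes unless `G(s)² - 4 ≤ p²`, that is, except close to `x_crit`, where
`y = G² - 4` is an analytic coordinate. Substituting `y = p² τ` shows that the integral equals
`p³ H(p²)` with `H` holomorphic near `0` and `H(0) = 2ν`. Since `p` is holomorphic with a simple
zero at `w = -1`, this continues `k` to a disc and makes `ν` first appear at third order.
-/

namespace SineGordon

open MeasureTheory Asymptotics Complex Metric

/-! ### Integrals and square roots -/

theorem exists_norm_lt_of_integrableOn_Ioi {F : Type*} [NormedAddCommGroup F] {f : ℝ → F}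
    {a c : ℝ} (hf : IntegrableOn f (Ioi a)) (hc : 0 < c) : ∃ x ∈ Ioi a, ‖f x‖ < c := by
  by_contra! h
  have hconst : IntegrableOn (fun _ => c) (Ioi a) :=
    hf.norm.mono' aestronglyMeasurable_const <|
      ae_restrict_of_forall_mem measurableSet_Ioi fun x hx =>
        (Real.norm_of_nonneg hc.le).trans_le (h x hx)
  simp [integrableOn_const_iff, hc.ne'] at hconst

theorem cos_add_mul_sin_mem_slitPlane {c : ℂ} (hc : c.im ≠ 0) {φ : ℝ} (hφ : φ ∈ Ico 0 Real.pi) :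
    cos φ + c * sin φ ∈ slitPlane := by
  rcases hφ.1.eq_or_lt with rfl | h
  · simp
  · exact Or.inr (by simp [sin_ofReal_re, hc, (Real.sin_pos_of_pos_of_lt_pi h hφ.2).ne'])

theorem cos_sq_sub_mul_sin_sq_ne_zero {c : ℂ} (hc : c.im ≠ 0) {φ : ℝ} (hφ : φ ∈ Ico 0 Real.pi) :
    cos φ ^ 2 - c ^ 2 * sin φ ^ 2 ≠ 0 := by
  have h := mul_ne_zero
    (slitPlane_ne_zero (cos_add_mul_sin_mem_slitPlane hc hφ))
    (slitPlane_ne_zero (cos_add_mul_sin_mem_slitPlane (c := -c) (by simpa using hc) hφ))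
  contrapose h
  linear_combination h

theorem hasDerivAt_log_cos_add_mul_sin {c : ℂ} (hc : c.im ≠ 0) {φ : ℝ} (hφ : φ ∈ Ico 0 Real.pi) :
    HasDerivAt (fun φ : ℝ => log (cos φ + c * sin φ))
      ((-sin φ + c * cos φ) / (cos φ + c * sin φ)) φ :=
  ((hasDerivAt_cos (φ : ℂ)).comp_ofReal.add
    ((hasDerivAt_sin (φ : ℂ)).comp_ofReal.const_mul c)).clog_real
      (cos_add_mul_sin_mem_slitPlane hc hφ)

theorem integral_inv_cos_sq_sub_mul_sin_sq {c : ℂ} (hc : 0 < c.im) :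
    ∫ φ in (0 : ℝ)..(Real.pi / 2), (cos φ ^ 2 - c ^ 2 * sin φ ^ 2)⁻¹ = Real.pi * I / (2 * c) := by
  have hc0 : c ≠ 0 := fun h => by simp [h] at hc
  have hneg : (-c).im ≠ 0 := by simpa using hc.ne'
  have hpi : ∀ φ ∈ uIcc (0 : ℝ) (Real.pi / 2), φ ∈ Ico 0 Real.pi := fun φ hφ => by
    rw [uIcc_of_le (by positivity)] at hφ
    exact ⟨hφ.1, by linarith [hφ.2, Real.pi_pos]⟩
  have hderiv : ∀ φ ∈ uIcc (0 : ℝ) (Real.pi / 2), HasDerivAt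
      (fun φ : ℝ => (log (cos φ + c * sin φ) - log (cos φ + -c * sin φ)) / (2 * c))
      ((cos φ ^ 2 - c ^ 2 * sin φ ^ 2)⁻¹) φ := by
    intro φ hφ
    refine (((hasDerivAt_log_cos_add_mul_sin hc.ne' (hpi φ hφ)).sub
      (hasDerivAt_log_cos_add_mul_sin hneg (hpi φ hφ))).div_const (2 * c)).congr_deriv ?_
    have h₁ := slitPlane_ne_zero (cos_add_mul_sin_mem_slitPlane hc.ne' (hpi φ hφ))
    have h₂ := slitPlane_ne_zero (cos_add_mul_sin_mem_slitPlane hneg (hpi φ hφ))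
    have hden := cos_sq_sub_mul_sin_sq_ne_zero hc.ne' (hpi φ hφ)
    rw [div_sub_div _ _ h₁ h₂, div_div, ← mul_eq_one_iff_eq_inv₀ hden, div_mul_eq_mul_div,
      div_eq_one_iff_eq (mul_ne_zero (mul_ne_zero h₁ h₂) (mul_ne_zero two_ne_zero hc0))]
    linear_combination (2 * c * (cos φ ^ 2 - c ^ 2 * sin φ ^ 2)) * sin_sq_add_cos_sq (φ : ℂ)
  have hlog : log c - log (-c) = Real.pi * I := by
    rw [log, log, norm_neg, arg_neg_eq_arg_sub_pi_of_im_pos hc]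
    push_cast
    ring
  rw [intervalIntegral.integral_eq_sub_of_hasDerivAt hderiv]
  · rw [← ofReal_cos, ← ofReal_sin, Real.cos_pi_div_two, Real.sin_pi_div_two]
    simp [hlog]
  · exact ContinuousOn.intervalIntegrable fun φ hφ => ContinuousWithinAt.inv₀ (by fun_prop)
      (cos_sq_sub_mul_sin_sq_ne_zero hc.ne' (hpi φ hφ))

theorem cpow_half_sq (y : ℂ) : (y ^ (1 / 2 : ℂ)) ^ 2 = y := by
  rw [one_div, cpow_ofNat_inv_pow]

theorem cpow_half_re_pos {y : ℂ} (hy : y ∈ slitPlane) : 0 < (y ^ (1 / 2 : ℂ)).re := by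
  rw [one_div, cpow_inv_two_re, Real.sqrt_pos]
  rcases hy with hre | him
  · positivity
  · linarith [neg_abs_le y.re, abs_re_lt_norm.2 him]

theorem integral_cos_sq_div {ζ : ℂ} (hζ : 1 - ζ ∈ slitPlane) :
    ∫ φ in (0 : ℝ)..(Real.pi / 2), ζ * cos φ ^ 2 / (1 - ζ * sin φ ^ 2) =
      Real.pi / 2 * (1 - (1 - ζ) ^ (1 / 2 : ℂ)) := by
  set R := (1 - ζ) ^ (1 / 2 : ℂ)
  have hR : 0 < R.re := cpow_half_re_pos hζ
  have : R ≠ 0 := fun h => by simp [h] at hR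
  have hζR : ζ = 1 + (I * R) ^ 2 := by
    rw [mul_pow, I_sq, cpow_half_sq]
    ring
  have hIR : 0 < (I * R).im := by simpa using hR
  have hpi : ∀ φ ∈ uIcc (0 : ℝ) (Real.pi / 2), φ ∈ Ico 0 Real.pi := fun φ hφ => by
    rw [uIcc_of_le (by positivity)] at hφ
    exact ⟨hφ.1, by linarith [hφ.2, Real.pi_pos]⟩
  have hsplit : ∀ φ ∈ uIcc (0 : ℝ) (Real.pi / 2), ζ * cos φ ^ 2 / (1 - ζ * sin φ ^ 2) =
      1 + (I * R) ^ 2 * (cos φ ^ 2 - (I * R) ^ 2 * sin φ ^ 2)⁻¹ := by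
    intro φ hφ
    have hden := cos_sq_sub_mul_sin_sq_ne_zero hIR.ne' (hpi φ hφ)
    have hcs := sin_sq_add_cos_sq (φ : ℂ)
    rw [show 1 - ζ * sin φ ^ 2 = cos φ ^ 2 - (I * R) ^ 2 * sin φ ^ 2 by
      rw [hζR]; linear_combination -hcs, div_eq_iff hden, add_mul, mul_assoc,
      inv_mul_cancel₀ hden, hζR]
    linear_combination (I * R) ^ 2 * hcs
  have hint : IntervalIntegrable (fun φ : ℝ => (cos φ ^ 2 - (I * R) ^ 2 * sin φ ^ 2)⁻¹)
      volume 0 (Real.pi / 2) :=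
    ContinuousOn.intervalIntegrable fun φ hφ => ContinuousWithinAt.inv₀ (by fun_prop)
      (cos_sq_sub_mul_sin_sq_ne_zero hIR.ne' (hpi φ hφ))
  rw [intervalIntegral.integral_congr hsplit, intervalIntegral.integral_add (by simp)
    (hint.const_mul _), intervalIntegral.integral_const_mul,
    integral_inv_cos_sq_sub_mul_sin_sq hIR, intervalIntegral.integral_const]
  simp only [sub_zero, real_smul, ofReal_div, ofReal_ofNat, mul_one]
  field_simp
  linear_combination R * I_sq

theorem integral_sqrt_sub_sq_div {m q : ℝ} (hm : 0 ≤ m) (hq : √m ≤ q) {P : ℂ} (hP : P ≠ 0)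
    (hmP : 1 - m / P ∈ slitPlane) :
    ∫ y in (0 : ℝ)..q, (√(m - y ^ 2) : ℂ) / (P - y ^ 2) =
      Real.pi / 2 * (1 - (1 - m / P) ^ (1 / 2 : ℂ)) := by
  have cos_nonneg : ∀ φ ∈ uIcc 0 (Real.pi / 2), 0 ≤ Real.cos φ := fun φ hφ => by
    rw [uIcc_of_le (by positivity)] at hφ
    exact Real.cos_nonneg_of_mem_Icc ⟨by linarith [hφ.1, Real.pi_pos], hφ.2⟩
  have hshrink : ∫ y in (0 : ℝ)..q, (√(m - y ^ 2) : ℂ) / (P - y ^ 2) =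
      ∫ y in (0 : ℝ)..√m, (√(m - y ^ 2) : ℂ) / (P - y ^ 2) := by
    rw [intervalIntegral.integral_of_le ((Real.sqrt_nonneg m).trans hq),
      intervalIntegral.integral_of_le (Real.sqrt_nonneg m)]
    refine setIntegral_eq_of_subset_of_forall_sdiff_eq_zero measurableSet_Ioc
      (Ioc_subset_Ioc_right hq) fun y hy => ?_
    have hy' : √m ≤ y := le_of_not_ge fun h => hy.2 ⟨hy.1.1, h⟩
    rw [Real.sqrt_eq_zero_of_nonpos (by linarith [(Real.sqrt_le_left hy.1.1.le).1 hy'])]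
    simp
  have hsubst := intervalIntegral.integral_deriv_smul_comp_of_deriv_nonneg (a := 0)
    (b := Real.pi / 2) (f := fun φ => √m * Real.sin φ)
    (g := fun y : ℝ => (√(m - y ^ 2) : ℂ) / (P - y ^ 2)) (by fun_prop)
    (fun φ _ => (Real.hasDerivAt_sin φ).const_mul _)
    (fun φ hφ => mul_nonneg (Real.sqrt_nonneg m) (cos_nonneg φ (Ioo_subset_Icc_self hφ)))
  rw [Real.sin_zero, mul_zero, Real.sin_pi_div_two, mul_one] at hsubst
  rw [hshrink, ← hsubst, ← integral_cos_sq_div hmP]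
  refine intervalIntegral.integral_congr fun φ hφ => ?_
  have hroot : √(m - (√m * Real.sin φ) ^ 2) = √m * Real.cos φ := by
    rw [mul_pow, Real.sq_sqrt hm, ← mul_one_sub, ← Real.cos_sq', Real.sqrt_mul hm,
      Real.sqrt_sq (cos_nonneg φ hφ)]
  have hsq : (√m : ℂ) ^ 2 = m := by exact_mod_cast Real.sq_sqrt hm
  have hden : (P - m * sin φ ^ 2 : ℂ) = P * (1 - m / P * sin φ ^ 2) := by field_simp
  simp only [Function.comp_apply, hroot, real_smul]
  push_cast
  rw [mul_pow, hsq, hden, ← mul_div_assoc, ← div_div]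
  congr 1
  rw [div_mul_eq_mul_div, ← hsq]
  ring

theorem one_sub_ofReal_div_mem_slitPlane {P : ℂ} (hP : P.im ≠ 0) (m : ℝ) :
    1 - m / P ∈ slitPlane := by
  rcases eq_or_ne m 0 with rfl | hm
  · simp
  · refine Or.inr ?_
    have : normSq P ≠ 0 := normSq_eq_zero.not.2 fun h => hP (by simp [h])
    simp [div_eq_mul_inv, inv_im, hm, hP, this]

theorem one_sub_ofReal_div_im (m : ℝ) (P : ℂ) : (1 - m / P).im = m * P.im / normSq P := by
  simp [div_eq_mul_inv, inv_im, mul_assoc]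

theorem ofReal_sub_ne_zero {z : ℂ} (hz : z.im ≠ 0) (s : ℝ) : (s : ℂ) - z ≠ 0 := fun h =>
  hz (by simpa using congrArg im h)

theorem integral_neg_exp_two_mul {F : Type*} [NormedAddCommGroup F] [NormedSpace ℝ F] (f : ℝ → F)
    (a b : ℝ) :
    ∫ u in a..b, (-(2 * Real.exp (2 * u))) • f (-Real.exp (2 * u)) =
      ∫ s in (-Real.exp (2 * a))..(-Real.exp (2 * b)), f s :=
  intervalIntegral.integral_deriv_smul_comp_of_deriv_nonpos (f := fun u => -Real.exp (2 * u))
    (by fun_prop)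
    (fun u _ => (((hasDerivAt_id u).const_mul 2).exp.neg).congr_deriv (by simp [mul_comm]))
    (fun u _ => by simp [Real.exp_nonneg])

theorem integral_neg_self_eq_integral_add {F : Type*} [NormedAddCommGroup F] [NormedSpace ℝ F]
    {f : ℝ → F} (hf : Continuous f) (a : ℝ) :
    ∫ u in (-a)..a, f u = ∫ u in (0 : ℝ)..a, (f u + f (-u)) := by
  rw [intervalIntegral.integral_add (hf.intervalIntegrable 0 a)
    ((hf.comp' continuous_neg).intervalIntegrable 0 a), intervalIntegral.integral_comp_neg,
    neg_zero, add_comm, intervalIntegral.integral_add_adjacent_intervals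
      (hf.intervalIntegrable (-a) 0) (hf.intervalIntegrable 0 a)]

theorem continuousAt_integral_div_sub {F y : ℝ → ℂ} {α β : ℝ} {w : ℂ}
    (hF : IntervalIntegrable F volume α β) (hy : Continuous y) (hw : ∀ φ ∈ uIcc α β, y φ ≠ w) :
    ContinuousAt (fun z => ∫ φ in α..β, F φ / (y φ - z)) w := by
  obtain ⟨φ₀, hφ₀, hmin⟩ := isCompact_uIcc.exists_isMinOn (nonempty_uIcc (a := α) (b := β))
    (f := fun φ => ‖y φ - w‖) (by fun_prop)
  set δ := ‖y φ₀ - w‖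
  have hδ : 0 < δ := norm_pos_iff.2 (sub_ne_zero.2 (hw φ₀ hφ₀))
  have hlow : ∀ z ∈ ball w (δ / 2), ∀ φ ∈ uIcc α β, δ / 2 ≤ ‖y φ - z‖ := by
    intro z hz φ hφ
    have hmin' : δ ≤ ‖y φ - w‖ := hmin hφ
    have hdist : ‖z - w‖ < δ / 2 := mem_ball_iff_norm.1 hz
    linarith [norm_sub_le_norm_sub_add_norm_sub (y φ) z w]
  refine intervalIntegral.continuousAt_of_dominated_interval
    (bound := fun φ => ‖F φ‖ * (δ / 2)⁻¹) (Eventually.of_forall fun z => ?_) ?_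
    (hF.norm.mul_const _) (Eventually.of_forall fun φ hφ => ?_)
  · simpa only [div_eq_mul_inv] using! hF.aestronglyMeasurable_restrict_uIoc.mul
      (hy.measurable.sub_const z).inv.aestronglyMeasurable
  · filter_upwards [ball_mem_nhds w (half_pos hδ)] with z hz
    refine Eventually.of_forall fun φ hφ => ?_
    rw [norm_div, div_eq_mul_inv]
    gcongr
    exact hlow z hz φ (uIoc_subset_uIcc hφ)
  · exact continuousAt_const.div (by fun_prop) (sub_ne_zero.2 (hw φ (uIoc_subset_uIcc hφ)))

theorem ae_exp_mul_I_ne_one : ∀ᵐ φ : ℝ, exp (φ * I) ≠ 1 := by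
  have hcount := countable_range fun n : ℤ => (n : ℝ) * (2 * Real.pi)
  filter_upwards [hcount.ae_notMem volume] with φ hφ hexp
  obtain ⟨n, hn⟩ := exp_eq_one_iff.1 hexp
  rw [← mul_assoc, ← mul_assoc] at hn
  exact hφ ⟨n, by exact_mod_cast (mul_assoc _ _ _).symm.trans (mul_right_cancel₀ I_ne_zero hn).symm⟩

theorem integral_sqrt_one_sub : ∫ τ in (0 : ℝ)..1, √(1 - τ) = 2 / 3 := by
  rw [intervalIntegral.integral_comp_sub_left (fun τ => √τ) 1]
  simp only [Real.sqrt_eq_rpow]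
  rw [integral_rpow (Or.inl (by norm_num))]
  norm_num

theorem integral_sqrt_sub_eq_of_rightInverse {Y φ φ' : ℝ → ℝ} {p : ℝ} (hp : 0 ≤ p)
    (hY : Continuous Y) (hφ : ∀ y ∈ Icc 0 (p ^ 2), HasDerivAt φ (φ' y) y)
    (hφ' : ContinuousOn φ' (Icc 0 (p ^ 2))) (hYφ : ∀ y ∈ Icc 0 (p ^ 2), Y (φ y) = y) :
    ∫ s in φ (p ^ 2)..φ 0, √(p ^ 2 - Y s) =
      p ^ 3 * ∫ τ in (0 : ℝ)..1, √(1 - τ) * -φ' (p ^ 2 * τ) := by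
  have hmem {τ : ℝ} (hτ : τ ∈ uIcc (0 : ℝ) 1) : p ^ 2 * τ ∈ Icc 0 (p ^ 2) := by
    rw [uIcc_of_le zero_le_one] at hτ
    exact ⟨mul_nonneg (sq_nonneg p) hτ.1, mul_le_of_le_one_right (sq_nonneg p) hτ.2⟩
  have hsubst := intervalIntegral.integral_comp_mul_deriv (a := 0) (b := 1)
    (f := fun τ => φ (p ^ 2 * τ)) (f' := fun τ => φ' (p ^ 2 * τ) * p ^ 2)
    (g := fun s => √(p ^ 2 - Y s))
    (fun τ hτ => (hφ _ (hmem hτ)).comp τ (hasDerivAt_const_mul _))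
    ((hφ'.comp (by fun_prop) fun τ hτ => hmem hτ).mul continuousOn_const) (by fun_prop)
  rw [mul_one, mul_zero] at hsubst
  rw [intervalIntegral.integral_symm, ← hsubst, ← intervalIntegral.integral_neg,
    ← intervalIntegral.integral_const_mul]
  refine intervalIntegral.integral_congr fun τ hτ => ?_
  have hsqrt : √(p ^ 2 - p ^ 2 * τ) = p * √(1 - τ) := by
    rw [← mul_one_sub, Real.sqrt_mul (sq_nonneg p), Real.sqrt_sq hp]
  simp only [Function.comp_apply, hYφ _ (hmem hτ), hsqrt]
  ring

/-- For `ε = ±1`, the square root of `y` whose imaginary part has the sign of `ε`. On the half-plane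
where `Im y` has this sign it is the principal root, but it is continuous on all of `ℂ`, which gives
the boundary values of the principal root on its branch cut. -/
noncomputable def signedRoot (ε : ℝ) (y : ℂ) : ℂ :=
  √((‖y‖ + y.re) / 2) + ε * √((‖y‖ - y.re) / 2) * I

theorem continuous_signedRoot (ε : ℝ) : Continuous (signedRoot ε) := by
  unfold signedRoot
  fun_prop

theorem cpow_half_eq_signedRoot_one {y : ℂ} (hy : 0 ≤ y.im) :
    y ^ (1 / 2 : ℂ) = signedRoot 1 y := by
  rw [← re_add_im (y ^ (1 / 2 : ℂ)), one_div, cpow_inv_two_re, cpow_inv_two_im_eq_sqrt hy,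
    signedRoot, ofReal_one, one_mul]

theorem cpow_half_eq_signedRoot_neg_one {y : ℂ} (hy : y.im < 0 ∨ y = 1) :
    y ^ (1 / 2 : ℂ) = signedRoot (-1) y := by
  rcases hy with hy | rfl
  · rw [← re_add_im (y ^ (1 / 2 : ℂ)), one_div, cpow_inv_two_re, cpow_inv_two_im_eq_neg_sqrt hy,
      signedRoot, ofReal_neg, ofReal_neg, ofReal_one, neg_one_mul]
  · simp [signedRoot]

theorem signedRoot_add_ofReal (y : ℝ) :
    signedRoot (-1) (y : ℂ) + signedRoot 1 (y : ℂ) = 2 * √y := by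
  have hroot : √((|y| + y) / 2) = √y := by
    rcases le_total 0 y with h | h
    · rw [abs_of_nonneg h, add_self_div_two]
    · rw [abs_of_nonpos h, Real.sqrt_eq_zero_of_nonpos h, neg_add_cancel, zero_div, Real.sqrt_zero]
  simp only [signedRoot, norm_real, Real.norm_eq_abs, ofReal_re, hroot]
  push_cast
  ring

theorem one_sub_signedRoot_add (m : ℝ) {p : ℝ} (hp : 0 < p) :
    (1 - signedRoot (-1) (1 - m / (p : ℂ) ^ 2)) + (1 - signedRoot 1 (1 - m / (p : ℂ) ^ 2)) =
      (2 / p * (p - √(p ^ 2 - m)) : ℝ) := by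
  have hreal : 1 - m / (p : ℂ) ^ 2 = ((p ^ 2 - m) / p ^ 2 : ℝ) := by
    rw [sub_div, div_self (by positivity)]
    push_cast
    rfl
  have hp' : (p : ℂ) ≠ 0 := ofReal_ne_zero.2 hp.ne'
  rw [hreal, sub_add_sub_comm, signedRoot_add_ofReal, Real.sqrt_div' _ (sq_nonneg p),
    Real.sqrt_sq hp.le]
  push_cast
  field_simp
  ring

/-! ### Power series -/

theorem exists_analyticAt_rightInverse {𝕜 : Type*} [NontriviallyNormedField 𝕜] [CompleteSpace 𝕜]
    [CharZero 𝕜] {f : 𝕜 → 𝕜} {a : 𝕜} (hf : AnalyticAt 𝕜 f a) (hf' : deriv f a ≠ 0) :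
    ∃ φ : 𝕜 → 𝕜, AnalyticAt 𝕜 φ (f a) ∧ φ (f a) = a ∧ deriv φ (f a) = (deriv f a)⁻¹ ∧
      ∀ᶠ y in 𝓝 (f a), f (φ y) = y :=
  ⟨_, hf.analyticAt_localInverse hf', HasStrictFDerivAt.localInverse_apply_image ..,
    (hf.hasStrictDerivAt.to_localInverse hf').hasDerivAt.deriv,
    HasStrictDerivAt.eventually_right_inverse ..⟩

theorem exists_summable_hasSum_of_analyticAt_zero {𝕜 : Type*} [NontriviallyNormedField 𝕜]
    {h : 𝕜 → 𝕜} (hh : AnalyticAt 𝕜 h 0) :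
    ∃ (a : ℕ → 𝕜) (r : ℝ), 0 < r ∧ Summable (fun n => ‖a n‖ * r ^ n) ∧
      ∀ y, ‖y‖ ≤ r → HasSum (fun n => a n * y ^ n) (h y) := by
  obtain ⟨p, R, hp⟩ := hh
  obtain ⟨r, hr0, hrR⟩ := ENNReal.lt_iff_exists_nnreal_btwn.1 hp.r_pos
  refine ⟨p.coeff, r, by exact_mod_cast hr0, ?_, fun y hy => ?_⟩
  · simpa only [p.norm_apply_eq_norm_coef] using p.summable_norm_mul_pow (hrR.trans_le hp.r_le)
  · have hy : y ∈ Metric.eball (0 : 𝕜) R := by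
      rw [mem_eball_zero_iff]
      exact (by exact_mod_cast hy : (‖y‖₊ : ENNReal) ≤ r).trans_lt hrR
    simpa only [zero_add, p.apply_eq_pow_smul_coeff, smul_eq_mul, mul_comm] using hp.hasSum hy

theorem hasSum_integral_mul_comp_mul {k h : ℝ → ℝ} (hk : IntervalIntegrable k volume 0 1)
    {a : ℕ → ℝ} {r : ℝ} (ha : Summable fun n => ‖a n‖ * r ^ n)
    (hsum : ∀ y, ‖y‖ ≤ r → HasSum (fun n => a n * y ^ n) (h y)) {y : ℝ} (hy : ‖y‖ ≤ r) :
    HasSum (fun n => a n * (∫ τ in (0 : ℝ)..1, k τ * τ ^ n) * y ^ n)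
      (∫ τ in (0 : ℝ)..1, k τ * h (y * τ)) := by
  have hterm (n : ℕ) : a n * (∫ τ in (0 : ℝ)..1, k τ * τ ^ n) * y ^ n =
      ∫ τ in (0 : ℝ)..1, k τ * (a n * (y * τ) ^ n) := by
    rw [← intervalIntegral.integral_const_mul, ← intervalIntegral.integral_mul_const]
    simp only [mul_pow, mul_left_comm, mul_comm]
  have hle {τ : ℝ} (hτ : τ ∈ uIoc (0 : ℝ) 1) : ‖y * τ‖ ≤ ‖y‖ := by
    rw [uIoc_of_le zero_le_one] at hτ
    rw [norm_mul, Real.norm_of_nonneg hτ.1.le]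
    exact mul_le_of_le_one_right (norm_nonneg _) hτ.2
  simp_rw [hterm]
  refine intervalIntegral.hasSum_integral_of_dominated_convergence
    (fun n τ => ‖k τ‖ * (‖a n‖ * r ^ n)) (fun n => ?_) (fun n => ?_) ?_ ?_ ?_
  · exact hk.aestronglyMeasurable_restrict_uIoc.mul
      (by fun_prop : Continuous _).aestronglyMeasurable
  · refine Eventually.of_forall fun τ hτ => ?_
    rw [norm_mul, norm_mul, norm_pow]
    gcongr
    exact (hle hτ).trans hy
  · exact Eventually.of_forall fun τ _ => ha.mul_left _
  · simp_rw [tsum_mul_left]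
    exact hk.norm.mul_const _
  · exact Eventually.of_forall fun τ hτ => (hsum _ ((hle hτ).trans hy)).mul_left _

theorem exists_holomorphic_average {k h : ℝ → ℝ} (hk : IntervalIntegrable k volume 0 1)
    (hh : AnalyticAt ℝ h 0) :
    ∃ (H : ℂ → ℂ) (r : ℝ), 0 < r ∧ DifferentiableOn ℂ H (ball 0 r) ∧
      ∀ y : ℝ, ‖y‖ < r → H y = (∫ τ in (0 : ℝ)..1, k τ * h (y * τ) : ℝ) := by
  obtain ⟨a, r, hr, ha, hsum⟩ := exists_summable_hasSum_of_analyticAt_zero hh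
  set moment : ℕ → ℝ := fun n => ∫ τ in (0 : ℝ)..1, k τ * τ ^ n
  have hmoment (n : ℕ) : ‖moment n‖ ≤ ∫ τ in (0 : ℝ)..1, ‖k τ‖ := by
    refine intervalIntegral.norm_integral_le_of_norm_le zero_le_one
      (Eventually.of_forall fun τ hτ => ?_) hk.norm
    rw [norm_mul, norm_pow, Real.norm_of_nonneg hτ.1.le]
    exact mul_le_of_le_one_right (norm_nonneg _) (pow_le_one₀ hτ.1.le hτ.2)
  refine ⟨fun ζ => ∑' n, (a n * moment n : ℝ) * ζ ^ n, r, hr, ?_, fun y hy => ?_⟩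
  · refine Complex.differentiableOn_tsum_of_summable_norm
      (ha.mul_right (∫ τ in (0 : ℝ)..1, ‖k τ‖)) (fun n => by fun_prop) Metric.isOpen_ball
      fun n ζ hζ => ?_
    rw [mem_ball_zero_iff] at hζ
    rw [norm_mul, norm_pow, Complex.norm_real, norm_mul, mul_right_comm]
    gcongr
    exact hmoment n
  · rw [← (hasSum_integral_mul_comp_mul hk ha hsum hy.le).tsum_eq]
    push_cast
    rfl

theorem isBigO_of_eventuallyEq_mul {X 𝕜 : Type*} [TopologicalSpace X] [NormedField 𝕜]
    {f g q : X → 𝕜} {a : X} (hq : ContinuousAt q a)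
    (hf : f =ᶠ[𝓝 a] fun w => g w * q w) : f =O[𝓝 a] g := by
  simpa using hf.trans_isBigO ((isBigO_refl g (𝓝 a)).mul (hq.isBigO_one 𝕜))

theorem isBigO_sub_of_sq_sub_sq {X 𝕜 : Type*} [TopologicalSpace X] [NormedField 𝕜]
    {f P g : X → 𝕜} {a : X} (hf : ContinuousAt f a) (hP : ContinuousAt P a)
    (hadd : f a + P a ≠ 0) (hsq : (fun w => f w ^ 2 - P w ^ 2) =O[𝓝 a] g) :
    (fun w => f w - P w) =O[𝓝 a] g := by
  have hinv : (fun w => (f w + P w)⁻¹) =O[𝓝 a] fun _ => (1 : 𝕜) :=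
    ((hf.add hP).inv₀ hadd).isBigO_one 𝕜
  refine ((hsq.mul hinv).congr' ?_ (Eventually.of_forall fun w => mul_one (g w)))
  filter_upwards [(hf.fun_add hP).eventually_ne hadd] with w hw
  rw [sq_sub_sq, mul_right_comm, mul_inv_cancel₀ hw, one_mul]

theorem isBigO_sub_affine_of_analyticAt {𝕜 : Type*} [NontriviallyNormedField 𝕜] {f : 𝕜 → 𝕜}
    {f' a : 𝕜} (hf : AnalyticAt 𝕜 f a) (hf' : HasDerivAt f f' a) :
    (fun w => f w - (f a + f' * (w - a))) =O[𝓝 a] fun w => (w - a) ^ 2 := by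
  obtain ⟨p, hp⟩ := hf
  have hsub : Tendsto (fun w => w - a) (𝓝 a) (𝓝 0) := by
    simpa using (continuous_sub_right a).tendsto a
  have htaylor := (hp.isBigO_sub_partialSum_pow 2).comp_tendsto hsub
  refine (htaylor.congr_left fun w => ?_).trans (isBigO_of_le _ fun w => by simp)
  have hcoeff1 : p.coeff 1 = f' := hp.deriv.symm.trans hf'.deriv
  have hcoeff0 : p.coeff 0 = f a := hp.coeff_zero _
  simp [FormalMultilinearSeries.partialSum, Finset.sum_range_succ, hcoeff0, hcoeff1, mul_comm]

theorem exists_hasSum_affine_taylor {A B C : ℂ → ℂ} {c : ℂ} {r : ℝ}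
    (hA : DifferentiableOn ℂ A (ball c r)) (hB : DifferentiableOn ℂ B (ball c r))
    (hC : DifferentiableOn ℂ C (ball c r)) :
    ∃ α β γ : ℕ → ℂ, ∀ a b : ℂ, ∀ w ∈ ball c r,
      HasSum (fun n => (α n * a + β n * b + γ n) * (w - c) ^ n) (A w * a + B w * b + C w) := by
  refine ⟨fun n => (n.factorial : ℂ)⁻¹ * iteratedDeriv n A c,
    fun n => (n.factorial : ℂ)⁻¹ * iteratedDeriv n B c,
    fun n => (n.factorial : ℂ)⁻¹ * iteratedDeriv n C c, fun a b w hw => ?_⟩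
  have hsum := (((hasSum_taylorSeries_on_ball hA hw).mul_right a).add
    ((hasSum_taylorSeries_on_ball hB hw).mul_right b)).add (hasSum_taylorSeries_on_ball hC hw)
  refine hsum.congr_fun fun n => ?_
  simp only [smul_eq_mul]
  ring

theorem exists_norm_affine_le_of_isBigO {X 𝕜 : Type*} [PseudoMetricSpace X] [NormedField 𝕜]
    {A B C g : X → 𝕜} {c : X} (hA : A =O[𝓝 c] g) (hB : B =O[𝓝 c] g) (hC : C =O[𝓝 c] g) (R : ℝ) :
    ∃ M δ : ℝ, 0 < δ ∧ ∀ a b : 𝕜, ‖a‖ ≤ R → ‖b‖ ≤ R → ∀ w ∈ ball c δ,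
      ‖A w * a + B w * b + C w‖ ≤ M * ‖g w‖ := by
  obtain ⟨MA, hMA⟩ := hA.bound
  obtain ⟨MB, hMB⟩ := hB.bound
  obtain ⟨MC, hMC⟩ := hC.bound
  obtain ⟨δ, hδ, hbound⟩ := eventually_nhds_iff_ball.1 (hMA.and (hMB.and hMC))
  refine ⟨MA * R + MB * R + MC, δ, hδ, fun a b ha hb w hw => ?_⟩
  obtain ⟨hAw, hBw, hCw⟩ := hbound w hw
  calc ‖A w * a + B w * b + C w‖ ≤ ‖A w‖ * ‖a‖ + ‖B w‖ * ‖b‖ + ‖C w‖ := by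
        rw [← norm_mul, ← norm_mul]
        exact norm_add₃_le
    _ ≤ MA * ‖g w‖ * R + MB * ‖g w‖ * R + MC * ‖g w‖ := by
        have := (norm_nonneg _).trans hAw
        have := (norm_nonneg _).trans hBw
        gcongr
    _ = (MA * R + MB * R + MC) * ‖g w‖ := by ring

/-! ### The root `(-w)^{1/2}` -/

theorem rt_sq (w : ℂ) : rt w ^ 2 = -w := cpow_half_sq _

theorem rt_ne_zero {w : ℂ} (hw : w ≠ 0) : rt w ≠ 0 := fun h => hw <| by
  simpa [h] using rt_sq w

theorem rt_neg_exp (u : ℝ) : rt ((-Real.exp (2 * u) : ℝ) : ℂ) = Real.exp u := by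
  rw [rt, ofReal_neg, neg_neg, one_div, ← ofReal_ofNat, ← ofReal_inv,
    ← ofReal_cpow (Real.exp_pos _).le, ← Real.exp_mul]
  congr 2
  ring

theorem rt_neg_one : rt (-1) = 1 := by
  rw [rt, neg_neg, one_cpow]

theorem rt_eq_neg_mul_inv_rt {w : ℂ} (hw : w ≠ 0) : rt w = -w * (rt w)⁻¹ := by
  rw [← rt_sq, sq, mul_inv_cancel_right₀ (rt_ne_zero hw)]

theorem norm_rt_of_norm_eq_one {w : ℂ} (hw : ‖w‖ = 1) : ‖rt w‖ = 1 := by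
  have h : ‖rt w‖ ^ 2 = 1 := by rw [← norm_pow, rt_sq, norm_neg, hw]
  exact (pow_eq_one_iff_of_nonneg (norm_nonneg _) two_ne_zero).1 h

theorem differentiableAt_rt {w : ℂ} (hw : -w ∈ slitPlane) : DifferentiableAt ℂ rt w :=
  differentiableAt_id.neg.cpow_const hw

theorem differentiableAt_inv_rt {w : ℂ} (hw : -w ∈ slitPlane) :
    DifferentiableAt ℂ (fun w => (rt w)⁻¹) w :=
  (differentiableAt_rt hw).inv (rt_ne_zero (neg_ne_zero.1 (slitPlane_ne_zero hw)))

theorem E_neg_exp (u : ℝ) : E ((-Real.exp (2 * u) : ℝ) : ℂ) = I / 2 * Real.cosh u := by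
  rw [E, rt_neg_exp, Real.cosh_eq, Real.exp_neg]
  push_cast
  ring

theorem differentiableAt_D {w : ℂ} (hw : -w ∈ slitPlane) : DifferentiableAt ℂ D w :=
  ((differentiableAt_rt hw).sub (differentiableAt_inv_rt hw)).const_mul _

theorem differentiableAt_E {w : ℂ} (hw : -w ∈ slitPlane) : DifferentiableAt ℂ E w :=
  ((differentiableAt_rt hw).add (differentiableAt_inv_rt hw)).const_mul _

theorem four_mul_E_im_of_norm_eq_one {w : ℂ} (hw : ‖w‖ = 1) : 4 * (E w).im = 2 * (rt w).re := by
  rw [E, inv_eq_conj (norm_rt_of_norm_eq_one hw), add_conj,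
    show I / 4 * ((2 * (rt w).re : ℝ) : ℂ) = (2 * (rt w).re / 4 : ℝ) * I by push_cast; ring,
    im_ofReal_mul, I_im]
  ring

open scoped ComplexOrder in
theorem four_mul_E_im_mem_Ioc {w : ℂ} (hw : ‖w‖ = 1) (hw1 : w ≠ 1) : 4 * (E w).im ∈ Ioc 0 2 := by
  have hslit : -w ∈ slitPlane := by
    rw [mem_slitPlane_iff_not_le_zero, neg_nonpos]
    exact fun h => hw1 (by rw [eq_coe_norm_of_nonneg h, hw, ofReal_one])
  have hpos : 0 < (rt w).re := cpow_half_re_pos hslit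
  have hle : (rt w).re ≤ 1 := (re_le_norm _).trans_eq (norm_rt_of_norm_eq_one hw)
  rw [four_mul_E_im_of_norm_eq_one hw]
  exact ⟨by linarith, by linarith⟩

/-- The combination `(-w)^{1/2} - (-w)^{-1/2}`, equal to `-4i D(w)`. It serves as a coordinate near
its simple zero `w = -1`, and it is `2 sinh u` at `w = -exp(2u)`. -/
noncomputable def rootGap (w : ℂ) : ℂ := rt w - (rt w)⁻¹

theorem D_eq (w : ℂ) : D w = I / 4 * rootGap w := rfl

theorem rootGap_sq {w : ℂ} (hw : w ≠ 0) : rootGap w ^ 2 = -(w + 1) ^ 2 / w := by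
  have h := rt_ne_zero hw
  have hsq := rt_sq w
  rw [rootGap, eq_div_iff hw]
  field_simp
  rw [hsq]
  ring

theorem rootGap_ne_zero {w : ℂ} (hw0 : w ≠ 0) (hw1 : w ≠ -1) : rootGap w ≠ 0 := by
  rw [← pow_ne_zero_iff two_ne_zero, rootGap_sq hw0]
  exact div_ne_zero (neg_ne_zero.2 (pow_ne_zero 2 (mt eq_neg_of_add_eq_zero_left hw1))) hw0

theorem rootGap_neg_exp (u : ℝ) :
    rootGap ((-Real.exp (2 * u) : ℝ) : ℂ) = (2 * Real.sinh u : ℝ) := by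
  rw [rootGap, rt_neg_exp, Real.sinh_eq, Real.exp_neg]
  push_cast
  ring

theorem rootGap_eq_neg_mul_inv_rt {w : ℂ} (hw : w ≠ 0) : rootGap w = -(w + 1) * (rt w)⁻¹ := by
  rw [rootGap]
  linear_combination rt_eq_neg_mul_inv_rt hw

theorem differentiableAt_rootGap {w : ℂ} (hw : -w ∈ slitPlane) : DifferentiableAt ℂ rootGap w :=
  (differentiableAt_rt hw).sub (differentiableAt_inv_rt hw)

theorem rootGap_sq_im {w : ℂ} (hw : w ≠ 0) :
    (rootGap w ^ 2).im = -w.im * (1 - (‖w‖ ^ 2)⁻¹) := by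
  rw [rootGap_sq hw, show -(w + 1) ^ 2 / w = -w - 2 - w⁻¹ by field_simp; ring]
  simp only [sub_im, neg_im, im_ofNat, inv_im, normSq_eq_norm_sq]
  ring

theorem one_sub_inv_norm_sq_pos {w : ℂ} (hnorm : 1 < ‖w‖) : 0 < 1 - (‖w‖ ^ 2)⁻¹ :=
  sub_pos.2 (inv_lt_one_of_one_lt₀ (one_lt_pow₀ hnorm two_ne_zero))

theorem rootGap_sq_im_neg {w : ℂ} (him : 0 < w.im) (hnorm : 1 < ‖w‖) : (rootGap w ^ 2).im < 0 := by
  rw [rootGap_sq_im fun h => him.ne' (by simp [h])]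
  exact mul_neg_of_neg_of_pos (neg_lt_zero.2 him) (one_sub_inv_norm_sq_pos hnorm)

theorem rootGap_sq_im_pos {w : ℂ} (him : w.im < 0) (hnorm : 1 < ‖w‖) : 0 < (rootGap w ^ 2).im := by
  rw [rootGap_sq_im fun h => him.ne (by simp [h])]
  exact mul_pos (neg_pos.2 him) (one_sub_inv_norm_sq_pos hnorm)

theorem rootGap_sq_im_ne_zero {w : ℂ} (him : w.im ≠ 0) (hnorm : 1 < ‖w‖) :
    (rootGap w ^ 2).im ≠ 0 := by
  rcases him.lt_or_gt with h | h
  exacts [(rootGap_sq_im_pos h hnorm).ne', (rootGap_sq_im_neg h hnorm).ne]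

theorem neg_ofReal_mem_slitPlane {w : ℝ} (hw : w < 0) : -(w : ℂ) ∈ slitPlane := by
  rw [← ofReal_neg, ofReal_mem_slitPlane]
  exact neg_pos.2 hw

theorem eventually_one_lt_norm {w : ℝ} (hw : w < -1) : ∀ᶠ z : ℂ in 𝓝 (w : ℂ), 1 < ‖z‖ := by
  refine continuous_norm.continuousAt.eventually_const_lt (?_ : 1 < ‖(w : ℂ)‖)
  rw [norm_real, Real.norm_eq_abs, abs_of_neg (by linarith)]
  linarith

theorem neg_exp_log_neg {s : ℝ} (hs : s < 0) : -Real.exp (2 * (Real.log (-s) / 2)) = s := by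
  rw [mul_div_cancel₀ _ two_ne_zero, Real.exp_log (neg_pos.2 hs), neg_neg]

theorem exp_two_mul_add_ne_zero {z : ℂ} (hz : z.im ≠ 0) (u : ℝ) :
    (Real.exp (2 * u) : ℂ) + z ≠ 0 := fun h => hz (by simpa [-ofReal_exp] using congrArg im h)

theorem exp_div_add_exp_neg_div {z : ℂ} (hz : z.im ≠ 0) (u : ℝ) :
    2 * Real.exp u / (Real.exp (2 * u) + z) + 2 * Real.exp (-u) / (Real.exp (2 * -u) + z) =
      -(2 * ((1 + z) / z)) *
        ((2 * Real.cosh u : ℝ) / (rootGap z ^ 2 - (2 * Real.sinh u : ℝ) ^ 2)) := by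
  have hz0 : z ≠ 0 := fun h => hz (by simp [h])
  have h₁ := exp_two_mul_add_ne_zero hz u
  have h₂ := exp_two_mul_add_ne_zero hz (-u)
  have he : (Real.exp u : ℂ) ≠ 0 := by exact_mod_cast (Real.exp_pos u).ne'
  have hsq : ∀ v, Real.exp (2 * v) = Real.exp v ^ 2 := fun v => by rw [← Real.exp_nat_mul]; simp
  have hden : rootGap z ^ 2 - (2 * Real.sinh u : ℝ) ^ 2 =
      -(Real.exp (2 * u) + z) * (Real.exp (2 * -u) + z) / z := by
    rw [rootGap_sq hz0, Real.sinh_eq, hsq, hsq, Real.exp_neg]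
    push_cast
    generalize (Real.exp u : ℂ) = e at he
    field_simp
    ring
  rw [hden, Real.cosh_eq, div_div_eq_mul_div, div_add_div _ _ h₁ h₂]
  rw [hsq, hsq, Real.exp_neg] at *
  push_cast at *
  generalize (Complex.exp u : ℂ) = e at *
  field_simp
  ring

/-- On the segment `s = -exp(2u)`, `|u| ≤ U`, the reflection `u ↦ -u`, i.e. `s ↦ 1/s`, turns the
Cauchy kernel into one that is rational in `2 sinh u`. -/
theorem integral_even_div_rt_div_sub {F f : ℝ → ℂ} {U : ℝ} (hf : Continuous f)
    (heven : ∀ y, f (-y) = f y)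
    (hF : ∀ u ∈ uIcc U (-U), F (-Real.exp (2 * u)) = f (2 * Real.sinh u)) {z : ℂ} (hz : z.im ≠ 0) :
    ∫ s in (-Real.exp (2 * U))..(-Real.exp (2 * -U)), F s / rt s / (s - z) =
      2 * ((1 + z) / z) *
        ∫ y in (0 : ℝ)..(2 * Real.sinh U), f y / (rootGap z ^ 2 - y ^ 2) := by
  set g : ℝ → ℂ := fun u => f (2 * Real.sinh u) * (2 * Real.exp u / (Real.exp (2 * u) + z))
  have hg : Continuous g := by
    refine (by fun_prop : Continuous _).mul (Continuous.div ?_ ?_ fun u =>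
      exp_two_mul_add_ne_zero hz u) <;> fun_prop
  have hpull : ∀ u ∈ uIcc U (-U), (-(2 * Real.exp (2 * u))) •
      (F (-Real.exp (2 * u)) / rt ((-Real.exp (2 * u) : ℝ) : ℂ) / ((-Real.exp (2 * u) : ℝ) - z)) =
      g u := by
    intro u hu
    have h := exp_two_mul_add_ne_zero hz u
    have h' : -(Real.exp (2 * u) : ℂ) - z ≠ 0 := fun h0 => h (by linear_combination -h0)
    have he : (Real.exp u : ℂ) ≠ 0 := by exact_mod_cast (Real.exp_pos u).ne'
    rw [hF u hu, rt_neg_exp, real_smul]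
    simp only [g]
    rw [show Real.exp (2 * u) = Real.exp u ^ 2 by rw [← Real.exp_nat_mul]; simp] at *
    push_cast at *
    generalize Complex.exp u = e at *
    field_simp
    ring
  have hsum : ∀ u, g u + g (-u) = -(2 * ((1 + z) / z)) *
      ((2 * Real.cosh u) •
        (f (2 * Real.sinh u) / (rootGap z ^ 2 - (2 * Real.sinh u : ℝ) ^ 2))) := by
    intro u
    simp only [g]
    rw [Real.sinh_neg, mul_neg, heven, ← mul_add, exp_div_add_exp_neg_div hz, real_smul]
    ring
  have hsubst := intervalIntegral.integral_deriv_smul_comp_of_deriv_nonneg (a := 0) (b := U)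
    (f := fun u => 2 * Real.sinh u) (g := fun y : ℝ => f y / (rootGap z ^ 2 - y ^ 2))
    (by fun_prop) (fun u _ => (Real.hasDerivAt_sinh u).const_mul 2) (fun u _ => by positivity)
  rw [Real.sinh_zero, mul_zero] at hsubst
  rw [← integral_neg_exp_two_mul, intervalIntegral.integral_congr hpull,
    intervalIntegral.integral_symm, integral_neg_self_eq_integral_add hg]
  simp_rw [hsum]
  rw [intervalIntegral.integral_const_mul, neg_mul, neg_neg, ← hsubst]
  rfl

/-! ### Expansions at `w = -1` -/

theorem eventually_neg_mem_slitPlane : ∀ᶠ w in 𝓝 (-1 : ℂ), -w ∈ slitPlane :=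
  continuous_neg.continuousAt.eventually_mem (isOpen_slitPlane.mem_nhds (by simp))

theorem eventually_ne_zero_nhds_neg_one : ∀ᶠ w in 𝓝 (-1 : ℂ), w ≠ 0 :=
  eventually_ne_nhds (neg_ne_zero.2 one_ne_zero)

theorem two_mul_I_mul_D_eq {w : ℂ} (hw : w ≠ 0) : 2 * I * D w = (w + 1) / 2 * (rt w)⁻¹ := by
  rw [D_eq, rootGap_eq_neg_mul_inv_rt hw]
  linear_combination -(w + 1) / 2 * (rt w)⁻¹ * I_sq

theorem two_mul_I_mul_E_eq {w : ℂ} (hw : w ≠ 0) : 2 * I * E w = (w - 1) / 2 * (rt w)⁻¹ := by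
  rw [E]
  linear_combination (rt w + (rt w)⁻¹) / 2 * I_sq - rt_eq_neg_mul_inv_rt hw / 2

/-- The truncation at `z ^ 4` of the binomial series of `(1 - z) ^ (-1/2)`. -/
noncomputable def invSqrtPoly (z : ℂ) : ℂ :=
  1 + z / 2 + 3 / 8 * z ^ 2 + 5 / 16 * z ^ 3 + 35 / 128 * z ^ 4

theorem continuous_invSqrtPoly : Continuous invSqrtPoly := by
  unfold invSqrtPoly
  fun_prop

theorem inv_rt_sub_invSqrtPoly_isBigO :
    (fun w => (rt w)⁻¹ - invSqrtPoly (w + 1)) =O[𝓝 (-1)] fun w => (w + 1) ^ 5 := by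
  have hslit := eventually_neg_mem_slitPlane.self_of_nhds
  refine isBigO_sub_of_sq_sub_sq (differentiableAt_inv_rt hslit).continuousAt
    (continuous_invSqrtPoly.comp (by fun_prop)).continuousAt
    (by norm_num [rt_neg_one, invSqrtPoly]) (isBigO_of_eventuallyEq_mul (q := fun w =>
      (63 / 128 + 105 / 512 * (w + 1) + 135 / 1024 * (w + 1) ^ 2 + 1575 / 16384 * (w + 1) ^ 3 +
        1225 / 16384 * (w + 1) ^ 4) / -w)
      (ContinuousAt.div (by fun_prop) (by fun_prop) (by simp)) ?_)
  filter_upwards [eventually_ne_zero_nhds_neg_one] with w hw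
  rw [inv_pow, rt_sq, invSqrtPoly]
  field_simp
  ring

theorem two_mul_I_mul_D_isBigO :
    (fun w => 2 * I * D w - (1 / 2 * (w + 1) + 1 / 4 * (w + 1) ^ 2 + 3 / 16 * (w + 1) ^ 3 +
      5 / 32 * (w + 1) ^ 4)) =O[𝓝 (-1)] fun w => (w + 1) ^ 5 := by
  have hfactor : (fun w : ℂ => (w + 1) / 2) =O[𝓝 (-1)] fun _ => (1 : ℂ) :=
    (by fun_prop : ContinuousAt (fun w : ℂ => (w + 1) / 2) (-1)).isBigO_one ℂ
  have hmul := hfactor.mul inv_rt_sub_invSqrtPoly_isBigO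
  simp only [one_mul] at hmul
  refine (hmul.add (isBigO_const_mul_self (35 / 256 : ℂ) _ _)).congr' ?_ EventuallyEq.rfl
  filter_upwards [eventually_ne_zero_nhds_neg_one] with w hw
  rw [two_mul_I_mul_D_eq hw, invSqrtPoly]
  ring

theorem two_mul_I_mul_E_isBigO :
    (fun w => 2 * I * E w - (-1 - 1 / 8 * (w + 1) ^ 2 - 1 / 8 * (w + 1) ^ 3 -
      15 / 128 * (w + 1) ^ 4)) =O[𝓝 (-1)] fun w => (w + 1) ^ 5 := by
  have hfactor : (fun w : ℂ => (w - 1) / 2) =O[𝓝 (-1)] fun _ => (1 : ℂ) :=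
    (by fun_prop : ContinuousAt (fun w : ℂ => (w - 1) / 2) (-1)).isBigO_one ℂ
  have hmul := hfactor.mul inv_rt_sub_invSqrtPoly_isBigO
  simp only [one_mul] at hmul
  refine (hmul.add (isBigO_const_mul_self (35 / 256 : ℂ) _ _)).congr' ?_ EventuallyEq.rfl
  filter_upwards [eventually_ne_zero_nhds_neg_one] with w hw
  rw [two_mul_I_mul_E_eq hw, invSqrtPoly]
  ring

theorem hasDerivAt_inv_rt_neg_one : HasDerivAt (fun w => (rt w)⁻¹) (1 / 2) (-1) := by
  have hrt : HasDerivAt rt _ (-1) := (hasDerivAt_neg (-1 : ℂ)).cpow_const (by simp)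
  refine (hrt.fun_inv (by simp [rt_neg_one])).congr_deriv ?_
  norm_num [rt_neg_one]

/-- The part of the phase function that does not depend on `x` and `t`, where `p ^ 3 * H (p ^ 2)`
is the holomorphic continuation of `∫ √(p² - (G² - 4))` over `[0, xcrit G]`. -/
noncomputable def cubicTerm (H : ℂ → ℂ) (w : ℂ) : ℂ :=
  -(rootGap w ^ 3 * H (rootGap w ^ 2) / 2)

theorem differentiableAt_cubicTerm {H : ℂ → ℂ} {w : ℂ} (hw : -w ∈ slitPlane)
    (hH : DifferentiableAt ℂ H (rootGap w ^ 2)) : DifferentiableAt ℂ (cubicTerm H) w := by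
  have hgap := differentiableAt_rootGap hw
  exact (((hgap.pow 3).mul (hH.comp (f := fun w => rootGap w ^ 2) w (hgap.pow 2))).div_const 2).neg

/-- After division by `(w + 1) ^ 3` only the value `ν` and the derivative `3 * ν / 2` of the
cofactor at `-1` matter; the argument of `H` is of second order there. -/
theorem cubicTerm_isBigO {H : ℂ → ℂ} {ν : ℂ} (hH : AnalyticAt ℂ H 0) (hH0 : H 0 = 2 * ν) :
    (fun w => cubicTerm H w - (ν * (w + 1) ^ 3 + 3 / 2 * ν * (w + 1) ^ 4)) =O[𝓝 (-1)]
      fun w => (w + 1) ^ 5 := by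
  set F : ℂ → ℂ := fun w => (rt w)⁻¹ ^ 3 * H (((w + 1) * (rt w)⁻¹) ^ 2) / 2
  have harg : ((-1 + 1) * (rt (-1))⁻¹) ^ 2 = 0 := by simp
  have hrt_analytic : AnalyticAt ℂ (fun w => (rt w)⁻¹) (-1) :=
    (analyticAt_id.neg.cpow analyticAt_const (by simp)).inv (by simp)
  have hF_analytic : AnalyticAt ℂ F (-1) :=
    ((hrt_analytic.pow 3).mul (AnalyticAt.comp (g := H) (f := fun w => ((w + 1) * (rt w)⁻¹) ^ 2)
      (by rwa [harg]) (((by fun_prop : AnalyticAt ℂ (fun w : ℂ => w + 1) (-1)).mul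
        hrt_analytic).pow 2))).div_const
  have hF_value : F (-1) = ν := by
    simp [F, rt_neg_one, hH0]
  have hF_deriv : HasDerivAt F (3 / 2 * ν) (-1) := by
    have hinv := hasDerivAt_inv_rt_neg_one
    have hcomp : HasDerivAt (fun w => H (((w + 1) * (rt w)⁻¹) ^ 2)) _ (-1) :=
      HasDerivAt.comp (-1) (by rw [harg]; exact hH.differentiableAt.hasDerivAt)
        ((((hasDerivAt_id (-1)).add_const 1).mul hinv).pow 2)
    refine (((hinv.fun_pow 3).fun_mul hcomp).div_const 2).congr_deriv ?_
    simp [rt_neg_one, hH0]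
    ring
  have hcube : (fun w : ℂ => (w + 1) ^ 3) =O[𝓝 (-1)] fun w => (w + 1) ^ 3 := isBigO_refl _ _
  have hmul := hcube.mul (isBigO_sub_affine_of_analyticAt hF_analytic hF_deriv)
  simp only [hF_value, sub_neg_eq_add, ← pow_add] at hmul
  refine hmul.congr' ?_ EventuallyEq.rfl
  filter_upwards [eventually_ne_zero_nhds_neg_one] with w hw
  simp only [F, cubicTerm, rootGap_eq_neg_mul_inv_rt hw, neg_mul, neg_sq]
  ring

variable {G : ℝ → ℝ}

/-! ### Monotone profiles -/

/-- A continuous profile that is strictly increasing and integrable on `[0, ∞)` and starts below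
`-2`. Such a profile increases to `0`, so that `Ginv` is a genuine inverse on `[G 0, 0)`. -/
structure IsMonotoneProfile (G : ℝ → ℝ) : Prop where
  continuous : Continuous G
  strictMonoOn : StrictMonoOn G (Ici 0)
  integrableOn : IntegrableOn G (Ioi 0)
  lt_neg_two : G 0 < -2

theorem IsImpulseProfile.isMonotoneProfile (hG : IsImpulseProfile G) : IsMonotoneProfile G where
  continuous := hG.contDiff.continuous
  strictMonoOn := strictMonoOn_of_deriv_pos (convex_Ici 0) hG.contDiff.continuous.continuousOn
    fun x hx => hG.deriv_pos x (by rwa [interior_Ici] at hx)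
  integrableOn := hG.integrable.integrableOn
  lt_neg_two := hG.kinks

namespace IsMonotoneProfile

theorem neg (hG : IsMonotoneProfile G) {x : ℝ} (hx : 0 ≤ x) : G x < 0 := by
  by_contra! h
  have hlt {y : ℝ} (hy : y ∈ Ioi x) : 0 < G y := h.trans_lt (hG.strictMonoOn hx (hx.trans hy.le) hy)
  obtain ⟨y, hy, hGy⟩ := exists_norm_lt_of_integrableOn_Ioi
    (hG.integrableOn.mono_set (Ioi_subset_Ioi (by linarith : 0 ≤ x + 1)))
    (hlt (lt_add_one x))
  rw [Real.norm_eq_abs, abs_of_pos (hlt ((lt_add_one x).trans hy))] at hGy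
  exact hGy.not_gt (hG.strictMonoOn (by simp; linarith) (by simp at hy ⊢; linarith) hy)

theorem exists_apply_eq (hG : IsMonotoneProfile G) {y : ℝ} (hy : y ∈ Ico (G 0) 0) :
    ∃ x ∈ Ici (0 : ℝ), G x = y := by
  obtain ⟨b, hb, hGb⟩ := exists_norm_lt_of_integrableOn_Ioi hG.integrableOn (neg_pos.2 hy.2)
  obtain ⟨x, hx, rfl⟩ := intermediate_value_Icc (le_of_lt hb) hG.continuous.continuousOn
    ⟨hy.1, by linarith [neg_abs_le (G b), Real.norm_eq_abs (G b)]⟩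
  exact ⟨x, hx.1, rfl⟩

theorem Ginv_nonneg (hG : IsMonotoneProfile G) {y : ℝ} (hy : y ∈ Ico (G 0) 0) : 0 ≤ Ginv G y :=
  Function.invFunOn_mem (hG.exists_apply_eq hy)

theorem apply_Ginv (hG : IsMonotoneProfile G) {y : ℝ} (hy : y ∈ Ico (G 0) 0) : G (Ginv G y) = y :=
  Function.invFunOn_eq (hG.exists_apply_eq hy)

theorem apply_xcrit (hG : IsMonotoneProfile G) : G (xcrit G) = -2 :=
  hG.apply_Ginv ⟨hG.lt_neg_two.le, by norm_num⟩

theorem xcrit_pos (hG : IsMonotoneProfile G) : 0 < xcrit G := by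
  refine (hG.Ginv_nonneg ⟨hG.lt_neg_two.le, by norm_num⟩).lt_of_ne fun h => hG.lt_neg_two.ne ?_
  rw [h]
  exact hG.apply_xcrit

theorem neg_apply_mem_Icc (hG : IsMonotoneProfile G) {x : ℝ} (hx : x ∈ Icc 0 (xcrit G)) :
    -G x ∈ Icc 2 (-G 0) := by
  have h0 := hG.strictMonoOn.monotoneOn self_mem_Ici hx.1 hx.1
  have h1 := hG.strictMonoOn.monotoneOn hx.1 hG.xcrit_pos.le hx.2
  rw [hG.apply_xcrit] at h1
  constructor <;> linarith

/-- Enlarging the range of integration beyond `G⁻¹(-v)` adds nothing, because `Real.sqrt` vanishes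
on the negative reals. -/
theorem Psi_eq_setIntegral (hG : IsMonotoneProfile G) {l : ℂ} (hl : 4 * l.im ∈ Ioc 0 (-G 0))
    {S : Set ℝ} (hS : MeasurableSet S) (hGS : Ioc 0 (Ginv G (-(4 * l.im))) ⊆ S) (hS0 : S ⊆ Ioi 0) :
    Psi G l = 1 / 2 * ∫ s in S, √(G s ^ 2 - (4 * l.im) ^ 2) := by
  have hy : -(4 * l.im) ∈ Ico (G 0) 0 := ⟨by linarith [hl.2], by linarith [hl.1]⟩
  rw [Psi, intervalIntegral.integral_of_le (hG.Ginv_nonneg hy)]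
  congr 1
  refine (setIntegral_eq_of_subset_of_forall_sdiff_eq_zero hS hGS fun s hs =>
    Real.sqrt_eq_zero_of_nonpos ?_).symm
  have hs0 : 0 < s := hS0 hs.1
  have hGs := hG.strictMonoOn.monotoneOn (hG.Ginv_nonneg hy) hs0.le
    (le_of_not_ge fun h => hs.2 ⟨hs0, h⟩)
  rw [hG.apply_Ginv hy] at hGs
  nlinarith [hG.neg hs0.le]

theorem Psi_eq_integral_Ioi (hG : IsMonotoneProfile G) {l : ℂ} (hl : 4 * l.im ∈ Ioc 0 (-G 0)) :
    Psi G l = 1 / 2 * ∫ s in Ioi 0, √(G s ^ 2 - (4 * l.im) ^ 2) :=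
  hG.Psi_eq_setIntegral hl measurableSet_Ioi Ioc_subset_Ioi_self subset_rfl

theorem Psi_eq_integral_xcrit (hG : IsMonotoneProfile G) {l : ℂ}
    (hl : 4 * l.im ∈ Icc 2 (-G 0)) :
    Psi G l = 1 / 2 * ∫ s in (0 : ℝ)..xcrit G, √(G s ^ 2 - (4 * l.im) ^ 2) := by
  have hy : -(4 * l.im) ∈ Ico (G 0) 0 := ⟨by linarith [hl.2], by linarith [hl.1]⟩
  have hle : Ginv G (-(4 * l.im)) ≤ xcrit G :=
    (hG.strictMonoOn.le_iff_le (hG.Ginv_nonneg hy) hG.xcrit_pos.le).1 <| by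
      rw [hG.apply_Ginv hy, hG.apply_xcrit]
      linarith [hl.1]
  rw [intervalIntegral.integral_of_le hG.xcrit_pos.le]
  exact hG.Psi_eq_setIntegral ⟨by linarith [hl.1], hl.2⟩ measurableSet_Ioc
    (Ioc_subset_Ioc_right hle) Ioc_subset_Ioi_self

theorem continuous_integral_Ioi (hG : IsMonotoneProfile G) :
    Continuous fun v : ℝ => ∫ s in Ioi (0 : ℝ), √(G s ^ 2 - v ^ 2) := by
  have hcont := hG.continuous
  refine continuous_of_dominated (bound := fun s => ‖G s‖)
    (fun v => (by fun_prop : Continuous _).aestronglyMeasurable)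
    (fun v => Eventually.of_forall fun s => ?_) hG.integrableOn.norm
    (Eventually.of_forall fun s => by fun_prop)
  rw [Real.norm_of_nonneg (Real.sqrt_nonneg _), Real.norm_eq_abs]
  exact Real.sqrt_le_iff.2 ⟨abs_nonneg _, by rw [sq_abs]; nlinarith [sq_nonneg v]⟩

end IsMonotoneProfile

/-! ### Boundary values on `(𝔞, -1)` -/

/-- The number `U > 0` for which `[𝔞, 𝔟]` is the set of all `-exp(2u)` with `|u| ≤ U`. -/
noncomputable def halfWidth (G : ℝ → ℝ) : ℝ := Real.arcosh (-G 0 / 2)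

/-- The function `θ₀` on `[𝔞, 𝔟]` in terms of `y = rootGap s`. There `-i E(s) = √(y² + 4) / 4`, and
the range of integration is enlarged to `[0, x_crit]`, which adds only zeros of `Real.sqrt`. -/
noncomputable def segmentAction (G : ℝ → ℝ) (y : ℝ) : ℝ :=
  1 / 2 * ∫ s in (0 : ℝ)..xcrit G, √(G s ^ 2 - 4 - y ^ 2)

namespace IsMonotoneProfile

theorem two_mul_cosh_halfWidth (hG : IsMonotoneProfile G) : 2 * Real.cosh (halfWidth G) = -G 0 := by
  rw [halfWidth, Real.cosh_arcosh (by linarith [hG.lt_neg_two])]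
  ring

theorem halfWidth_pos (hG : IsMonotoneProfile G) : 0 < halfWidth G :=
  Real.arcosh_pos (by linarith [hG.lt_neg_two])

theorem two_mul_sinh_halfWidth (hG : IsMonotoneProfile G) :
    2 * Real.sinh (halfWidth G) = √(G 0 ^ 2 - 4) := by
  have hsinh : 0 ≤ Real.sinh (halfWidth G) := Real.sinh_nonneg_iff.2 hG.halfWidth_pos.le
  rw [← Real.sqrt_sq (by positivity : 0 ≤ 2 * Real.sinh (halfWidth G)), mul_pow, Real.sinh_sq,
    ← neg_sq (G 0), ← hG.two_mul_cosh_halfWidth]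
  ring_nf

theorem endA_eq (hG : IsMonotoneProfile G) : endA G = -Real.exp (2 * halfWidth G) := by
  have hexp : 2 * Real.exp (halfWidth G) = √(G 0 ^ 2 - 4) - G 0 := by
    rw [← Real.cosh_add_sinh]
    linarith [hG.two_mul_cosh_halfWidth, hG.two_mul_sinh_halfWidth]
  rw [endA, ← hexp, two_mul (halfWidth G), Real.exp_add]
  ring

theorem endB_eq (hG : IsMonotoneProfile G) : endB G = -Real.exp (2 * -halfWidth G) := by
  have hexp : 2 * Real.exp (-halfWidth G) = -(√(G 0 ^ 2 - 4) + G 0) := by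
    rw [← Real.cosh_sub_sinh]
    linarith [hG.two_mul_cosh_halfWidth, hG.two_mul_sinh_halfWidth]
  rw [endB, ← neg_sq (√(G 0 ^ 2 - 4) + G 0), ← hexp, two_mul (-halfWidth G), Real.exp_add]
  ring

theorem endA_lt (hG : IsMonotoneProfile G) : endA G < -1 := by
  rw [hG.endA_eq, neg_lt_neg_iff, Real.one_lt_exp_iff]
  linarith [hG.halfWidth_pos]

theorem lt_endB (hG : IsMonotoneProfile G) : -1 < endB G := by
  rw [hG.endB_eq, neg_lt_neg_iff, Real.exp_lt_one_iff]
  linarith [hG.halfWidth_pos]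

theorem endB_neg (hG : IsMonotoneProfile G) : endB G < 0 := by
  rw [hG.endB_eq]
  exact neg_lt_zero.2 (Real.exp_pos _)

theorem abs_log_div_two_le (hG : IsMonotoneProfile G) {s : ℝ} (hs : s ∈ Icc (endA G) (endB G)) :
    |Real.log (-s) / 2| ≤ halfWidth G := by
  have hs0 : s < 0 := hs.2.trans_lt hG.endB_neg
  rw [hG.endA_eq, hG.endB_eq, ← neg_exp_log_neg hs0, mem_Icc, neg_le_neg_iff, neg_le_neg_iff,
    Real.exp_le_exp, Real.exp_le_exp] at hs
  exact abs_le.2 ⟨by linarith [hs.2], by linarith [hs.1]⟩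

theorem theta0_neg_exp (hG : IsMonotoneProfile G) {u : ℝ} (hu : |u| ≤ halfWidth G) :
    theta0 G ((-Real.exp (2 * u) : ℝ) : ℂ) = segmentAction G (2 * Real.sinh u) := by
  have him : 4 * (E ((-Real.exp (2 * u) : ℝ) : ℂ)).im = 2 * Real.cosh u := by
    rw [E_neg_exp, show I / 2 * Real.cosh u = (Real.cosh u / 2 : ℝ) * I by push_cast; ring,
      im_ofReal_mul, I_im]
    ring
  have hcosh : Real.cosh u ≤ Real.cosh (halfWidth G) :=
    Real.cosh_le_cosh.2 (by rwa [abs_of_pos hG.halfWidth_pos])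
  rw [theta0, hG.Psi_eq_integral_xcrit, him, segmentAction]
  · have hsub (s : ℝ) : G s ^ 2 - (2 * Real.cosh u) ^ 2 = G s ^ 2 - 4 - (2 * Real.sinh u) ^ 2 := by
      linear_combination -4 * Real.cosh_sq u
    simp_rw [hsub]
  · rw [him]
    exact ⟨by linarith [Real.one_le_cosh u], by linarith [hG.two_mul_cosh_halfWidth]⟩

theorem continuous_segmentAction (hG : IsMonotoneProfile G) : Continuous (segmentAction G) := by
  have hcont := hG.continuous
  refine continuous_const.mul
    (intervalIntegral.continuous_parametric_intervalIntegral_of_continuous' ?_ _ _)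
  fun_prop

theorem continuousOn_theta0_div_rt (hG : IsMonotoneProfile G) :
    ContinuousOn (fun s : ℝ => theta0 G s / rt s) (Icc (endA G) (endB G)) := by
  have hcont := hG.continuous_segmentAction
  have hlog : ContinuousOn (fun s : ℝ => Real.log (-s) / 2) (Icc (endA G) (endB G)) :=
    (continuousOn_neg.log fun s hs => (neg_pos.2 (hs.2.trans_lt hG.endB_neg)).ne').div_const 2
  have hquot : Continuous fun u : ℝ => (segmentAction G (2 * Real.sinh u) / Real.exp u : ℂ) :=
    Continuous.div (by fun_prop) (by fun_prop) fun u =>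
    ofReal_ne_zero.2 (Real.exp_pos u).ne'
  refine (hquot.comp_continuousOn hlog).congr fun s hs => ?_
  simp only [Function.comp_apply]
  rw [← hG.theta0_neg_exp (hG.abs_log_div_two_le hs), ← rt_neg_exp,
    neg_exp_log_neg (hs.2.trans_lt hG.endB_neg)]

theorem integral_segmentAction_div (hG : IsMonotoneProfile G) {P : ℂ} (hP : P.im ≠ 0) :
    ∫ y in (0 : ℝ)..(2 * Real.sinh (halfWidth G)), (segmentAction G y : ℂ) / (P - y ^ 2) =
      Real.pi / 4 * ∫ s in (0 : ℝ)..xcrit G, (1 - (1 - (G s ^ 2 - 4 : ℝ) / P) ^ (1 / 2 : ℂ)) := by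
  have hden (y : ℝ) : P - y ^ 2 ≠ 0 := fun h => hP <| by
    rw [sub_eq_zero.1 h, ← ofReal_pow, ofReal_im]
  have hpull (y : ℝ) : (segmentAction G y : ℂ) / (P - y ^ 2) =
      1 / 2 * ∫ s in (0 : ℝ)..xcrit G, (√(G s ^ 2 - 4 - y ^ 2) : ℂ) / (P - y ^ 2) := by
    rw [segmentAction, intervalIntegral.integral_div, intervalIntegral.integral_ofReal]
    push_cast
    ring
  have hinner : ∀ s ∈ uIcc 0 (xcrit G), ∫ y in (0 : ℝ)..(2 * Real.sinh (halfWidth G)),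
      (√(G s ^ 2 - 4 - y ^ 2) : ℂ) / (P - y ^ 2) =
        Real.pi / 2 * (1 - (1 - (G s ^ 2 - 4 : ℝ) / P) ^ (1 / 2 : ℂ)) := by
    intro s hs
    rw [uIcc_of_le hG.xcrit_pos.le] at hs
    obtain ⟨h2, h0⟩ := hG.neg_apply_mem_Icc hs
    refine integral_sqrt_sub_sq_div (by nlinarith) ?_ (fun h => hP (by simp [h]))
      (one_sub_ofReal_div_mem_slitPlane hP _)
    rw [hG.two_mul_sinh_halfWidth]
    exact Real.sqrt_le_sqrt (by nlinarith)
  have hcont : Continuous (Function.uncurry fun y s : ℝ =>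
      (√(G s ^ 2 - 4 - y ^ 2) : ℂ) / (P - y ^ 2)) := by
    have := hG.continuous
    exact Continuous.div (by fun_prop) (by fun_prop) fun p => hden p.1
  have hint := (hcont.continuousOn.integrableOn_compact (μ := volume)
    ((isCompact_uIcc (a := 0) (b := 2 * Real.sinh (halfWidth G))).prod
      (isCompact_uIcc (a := 0) (b := xcrit G)))).mono_set
        (prod_mono uIoc_subset_uIcc uIoc_subset_uIcc)
  simp_rw [hpull]
  rw [intervalIntegral.integral_const_mul, intervalIntegral_intervalIntegral_swap hint,
    intervalIntegral.integral_congr hinner, intervalIntegral.integral_const_mul]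
  ring

theorem integral_theta0_div_rt_div_sub (hG : IsMonotoneProfile G) {z : ℂ} (him : z.im ≠ 0)
    (hnorm : 1 < ‖z‖) :
    ∫ s in (endA G)..(endB G), theta0 G s / rt s / (s - z) =
      Real.pi / 2 * ((1 + z) / z) * ∫ s in (0 : ℝ)..xcrit G,
        (1 - (1 - (G s ^ 2 - 4 : ℝ) / rootGap z ^ 2) ^ (1 / 2 : ℂ)) := by
  have hcont := hG.continuous_segmentAction
  rw [hG.endA_eq, hG.endB_eq, integral_even_div_rt_div_sub
    (f := fun y => (segmentAction G y : ℂ)) (by fun_prop) (fun y => by simp [segmentAction])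
    (fun u hu => hG.theta0_neg_exp <| by
      rwa [uIcc_of_ge (by linarith [hG.halfWidth_pos]), mem_Icc, ← abs_le] at hu) him,
    hG.integral_segmentAction_div (rootGap_sq_im_ne_zero him hnorm)]
  ring

end IsMonotoneProfile

/-- The numerator of the Cauchy integrand of `L`, pulled back to the unit circle. -/
noncomputable def circleDensity (G : ℝ → ℝ) (φ : ℝ) : ℂ :=
  theta0 G (exp (φ * I)) / rt (exp (φ * I)) * (I * exp (φ * I))

theorem IsMonotoneProfile.intervalIntegrable_circleDensity (hG : IsMonotoneProfile G) (a b : ℝ) :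
    IntervalIntegrable (circleDensity G) volume a b := by
  set Φ : ℝ → ℝ := fun v => 1 / 2 * ∫ s in Ioi (0 : ℝ), √(G s ^ 2 - v ^ 2)
  have hΦ : Continuous Φ := continuous_const.mul hG.continuous_integral_Ioi
  obtain ⟨C, hC⟩ := isCompact_Icc.exists_bound_of_continuousOn (s := Icc (0 : ℝ) 2) hΦ.continuousOn
  have hnorm (φ : ℝ) : ‖exp (φ * I)‖ = 1 := norm_exp_ofReal_mul_I φ
  have heq : ∀ᵐ φ : ℝ, circleDensity G φ =
      (Φ (4 * (E (exp (φ * I))).im) : ℂ) / rt (exp (φ * I)) * (I * exp (φ * I)) := by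
    filter_upwards [ae_exp_mul_I_ne_one] with φ hφ
    have hv := four_mul_E_im_mem_Ioc (hnorm φ) hφ
    rw [circleDensity, theta0, hG.Psi_eq_integral_Ioi ⟨hv.1, by linarith [hv.2, hG.lt_neg_two]⟩]
  have hmeas : AEStronglyMeasurable (circleDensity G) volume := by
    have hrt : Measurable rt := by unfold rt; fun_prop
    have : Measurable E := by unfold E; fun_prop
    have hΦm := hΦ.measurable
    exact (by fun_prop : Measurable fun φ : ℝ => (Φ (4 * (E (exp (φ * I))).im) : ℂ) /
      rt (exp (φ * I)) * (I * exp (φ * I))).aestronglyMeasurable.congr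
        (heq.mono fun φ hφ => hφ.symm)
  rw [intervalIntegrable_iff]
  refine Measure.integrableOn_of_bounded (M := C) (by simp [uIoc]) hmeas (ae_restrict_of_ae ?_)
  filter_upwards [heq, ae_exp_mul_I_ne_one] with φ hφ hφ1
  have hv := hC _ (Ioc_subset_Icc_self (four_mul_E_im_mem_Ioc (hnorm φ) hφ1))
  rwa [hφ, norm_mul, norm_div, norm_mul, norm_rt_of_norm_eq_one (hnorm φ), hnorm, norm_I, norm_real,
    div_one, mul_one, mul_one]

/-- The Cauchy integral of `θ₀(s)(-s)^{-1/2}` over a real segment. -/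
noncomputable def segmentCauchy (G : ℝ → ℝ) (a b : ℝ) (z : ℂ) : ℂ :=
  ∫ s in a..b, theta0 G s / rt s / (s - z)

/-- The part of the Cauchy integral of `L` that has no jump across `(𝔞, -1)`. The orientation of
`(-1, 𝔟)` is opposite to that of `[𝔞, 𝔟]`, so taking out the whole segment leaves `-2` times the
integral over `(-1, 𝔟)`. -/
noncomputable def regularCauchy (G : ℝ → ℝ) (z : ℂ) : ℂ :=
  (∫ φ in Real.pi..0, circleDensity G φ / (exp (φ * I) - z)) +
    (∫ φ in (-Real.pi)..0, circleDensity G φ / (exp (φ * I) - z)) -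
    2 * segmentCauchy G (-1) (endB G) z

/-- The continuous extension to `(𝔞, -1)` of the Cauchy integral over `[𝔞, 𝔟]`, from the upper
half-plane for `ε = -1` and from the lower half-plane for `ε = 1`. -/
noncomputable def segmentBoundary (G : ℝ → ℝ) (ε : ℝ) (z : ℂ) : ℂ :=
  Real.pi / 2 * ((1 + z) / z) * ∫ s in (0 : ℝ)..xcrit G,
    (1 - signedRoot ε (1 - (G s ^ 2 - 4 : ℝ) / rootGap z ^ 2))

namespace IsMonotoneProfile

theorem continuousAt_regularCauchy (hG : IsMonotoneProfile G) {w : ℝ} (hw : w < -1) :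
    ContinuousAt (regularCauchy G) (w : ℂ) := by
  have hcircle (a b : ℝ) :
      ContinuousAt (fun z => ∫ φ in a..b, circleDensity G φ / (exp (φ * I) - z)) (w : ℂ) := by
    refine continuousAt_integral_div_sub (hG.intervalIntegrable_circleDensity a b) (by fun_prop)
      fun φ _ he => ?_
    have hnorm := norm_exp_ofReal_mul_I φ
    rw [he, norm_real, Real.norm_eq_abs, abs_of_neg (by linarith)] at hnorm
    linarith
  have hsegment : ContinuousAt (segmentCauchy G (-1) (endB G)) (w : ℂ) := by
    refine continuousAt_integral_div_sub (F := fun s : ℝ => theta0 G s / rt s)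
      (y := fun s : ℝ => (s : ℂ)) ?_ continuous_ofReal fun s hs h => ?_ <;>
    have huIcc := uIcc_of_le hG.lt_endB.le
    · refine (hG.continuousOn_theta0_div_rt.mono ?_).intervalIntegrable
      exact huIcc ▸ Icc_subset_Icc_left hG.endA_lt.le
    · rw [huIcc, ofReal_inj.1 h] at hs
      exact hw.not_ge hs.1
  exact ((hcircle _ _).add (hcircle _ _)).sub (hsegment.const_mul 2)

theorem L_eq (hG : IsMonotoneProfile G) {z : ℂ} (hz : z.im ≠ 0) :
    L G z = rt z / Real.pi * (segmentCauchy G (endA G) (endB G) z + regularCauchy G z) := by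
  have hle : endA G ≤ endB G := hG.endA_lt.le.trans hG.lt_endB.le
  have hcont : ContinuousOn (fun s : ℝ => theta0 G s / rt s / (s - z)) (Icc (endA G) (endB G)) :=
    hG.continuousOn_theta0_div_rt.div (by fun_prop) fun s _ => ofReal_sub_ne_zero hz s
  have hint {a b : ℝ} (ha : a ∈ Icc (endA G) (endB G)) (hb : b ∈ Icc (endA G) (endB G)) :
      IntervalIntegrable (fun s : ℝ => theta0 G s / rt s / (s - z)) volume a b :=
    (hcont.mono (ordConnected_Icc.uIcc_subset ha hb)).intervalIntegrable
  have hmem : (-1 : ℝ) ∈ Icc (endA G) (endB G) := ⟨hG.endA_lt.le, hG.lt_endB.le⟩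
  have hadd := intervalIntegral.integral_add_adjacent_intervals
    (hint (left_mem_Icc.2 hle) hmem) (hint hmem (right_mem_Icc.2 hle))
  have hcircle (φ : ℝ) : theta0 G (exp (φ * I)) / rt (exp (φ * I)) / (exp (φ * I) - z) *
      (I * exp (φ * I)) = circleDensity G φ / (exp (φ * I) - z) := by
    rw [circleDensity]
    ring
  rw [L, intPInf, regularCauchy, segmentCauchy, segmentCauchy, ← hadd,
    intervalIntegral.integral_symm (-1) (endB G)]
  simp only [hcircle]
  ring

theorem gfun_eq (hG : IsMonotoneProfile G) (x t : ℝ) {z : ℂ} (hz : z.im ≠ 0) (hnorm : 1 < ‖z‖) :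
    gfun G x t z = rt z / (2 * Real.pi) * regularCauchy G z + (rt z)⁻¹ * ((t - x) / 2) := by
  have hrt := rt_ne_zero (fun h => hz (by simp [h]) : z ≠ 0)
  have hint : ∫ s in (endA G)..(endB G), theta0 G s / (rt s * (s - z)) =
      segmentCauchy G (endA G) (endB G) z := by simp only [segmentCauchy, div_div]
  have hinv : (rt z)⁻¹ * z = -rt z := by
    rw [inv_mul_eq_iff_eq_mul₀ hrt, mul_neg, ← sq, rt_sq, neg_neg]
  rw [gfun, hfun, mfun, if_neg hnorm.le.not_gt, if_neg hnorm.le.not_gt, hint, hG.L_eq hz]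
  linear_combination (segmentCauchy G (endA G) (endB G) z / (2 * Real.pi)) * hinv

theorem continuousAt_segmentBoundary (hG : IsMonotoneProfile G) (ε : ℝ) {z : ℂ}
    (hz : -z ∈ slitPlane) (hz1 : z ≠ -1) : ContinuousAt (segmentBoundary G ε) z := by
  have hcont := hG.continuous
  have hroot := continuous_signedRoot ε
  have hz0 : z ≠ 0 := neg_ne_zero.1 (slitPlane_ne_zero hz)
  have hint : Continuous fun ξ : ℂ => ∫ s in (0 : ℝ)..xcrit G,
      (1 - signedRoot ε (1 - (G s ^ 2 - 4 : ℝ) * ξ)) :=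
    intervalIntegral.continuous_parametric_intervalIntegral_of_continuous' (by fun_prop) _ _
  have hinv : ContinuousAt (fun z => (rootGap z ^ 2)⁻¹) z :=
    ((differentiableAt_rootGap hz).continuousAt.pow 2).inv₀
      (pow_ne_zero 2 (rootGap_ne_zero hz0 hz1))
  have hquot : ContinuousAt (fun z : ℂ => (1 + z) / z) z :=
    ContinuousAt.div (by fun_prop) (by fun_prop) hz0
  unfold segmentBoundary
  simp only [div_eq_mul_inv _ (rootGap _ ^ 2)]
  exact (continuousAt_const.mul hquot).mul (hint.continuousAt.comp hinv)

theorem continuousAt_rt_mul_segmentBoundary_add (hG : IsMonotoneProfile G) (ε : ℝ) {w : ℝ}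
    (hw : w < -1) : ContinuousAt (fun z => rt z / Real.pi *
      (segmentBoundary G ε z + regularCauchy G z)) (w : ℂ) := by
  have hslit := neg_ofReal_mem_slitPlane (hw.trans neg_one_lt_zero)
  exact ((differentiableAt_rt hslit).continuousAt.div_const _).mul
    ((hG.continuousAt_segmentBoundary ε hslit (by exact_mod_cast hw.ne)).add
      (hG.continuousAt_regularCauchy hw))

theorem segmentCauchy_eq_of_im_pos (hG : IsMonotoneProfile G) {z : ℂ} (him : 0 < z.im)
    (hnorm : 1 < ‖z‖) : segmentCauchy G (endA G) (endB G) z = segmentBoundary G (-1) z := by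
  rw [segmentCauchy, hG.integral_theta0_div_rt_div_sub him.ne' hnorm, segmentBoundary]
  congr 1
  refine intervalIntegral.integral_congr fun s hs => ?_
  rw [uIcc_of_le hG.xcrit_pos.le] at hs
  have hm : 0 ≤ G s ^ 2 - 4 := by nlinarith [(hG.neg_apply_mem_Icc hs).1]
  rw [cpow_half_eq_signedRoot_neg_one]
  rcases hm.eq_or_lt with hm | hm
  · exact Or.inr (by simp [← hm])
  · refine Or.inl ?_
    have hP := rootGap_sq_im_neg him hnorm
    rw [one_sub_ofReal_div_im]
    exact div_neg_of_neg_of_pos (mul_neg_of_pos_of_neg hm hP)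
      (normSq_pos.2 fun h => hP.ne (by simp [h]))

theorem segmentCauchy_eq_of_im_neg (hG : IsMonotoneProfile G) {z : ℂ} (him : z.im < 0)
    (hnorm : 1 < ‖z‖) : segmentCauchy G (endA G) (endB G) z = segmentBoundary G 1 z := by
  rw [segmentCauchy, hG.integral_theta0_div_rt_div_sub him.ne hnorm, segmentBoundary]
  congr 1
  refine intervalIntegral.integral_congr fun s hs => ?_
  rw [uIcc_of_le hG.xcrit_pos.le] at hs
  have hm : 0 ≤ G s ^ 2 - 4 := by nlinarith [(hG.neg_apply_mem_Icc hs).1]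
  rw [cpow_half_eq_signedRoot_one]
  rw [one_sub_ofReal_div_im]
  exact div_nonneg (mul_nonneg hm (rootGap_sq_im_pos him hnorm).le) (normSq_nonneg _)

theorem tendsto_L_im_pos (hG : IsMonotoneProfile G) {w : ℝ} (hw : w < -1) :
    Tendsto (L G) (𝓝[{z : ℂ | 0 < z.im}] (w : ℂ))
      (𝓝 (rt w / Real.pi * (segmentBoundary G (-1) w + regularCauchy G w))) := by
  refine (hG.continuousAt_rt_mul_segmentBoundary_add (-1) hw).continuousWithinAt.tendsto.congr' ?_
  filter_upwards [self_mem_nhdsWithin, nhdsWithin_le_nhds (eventually_one_lt_norm hw)]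
    with z him hz
  rw [hG.L_eq him.ne', hG.segmentCauchy_eq_of_im_pos him hz]

theorem tendsto_L_im_neg (hG : IsMonotoneProfile G) {w : ℝ} (hw : w < -1) :
    Tendsto (L G) (𝓝[{z : ℂ | z.im < 0}] (w : ℂ))
      (𝓝 (rt w / Real.pi * (segmentBoundary G 1 w + regularCauchy G w))) := by
  refine (hG.continuousAt_rt_mul_segmentBoundary_add 1 hw).continuousWithinAt.tendsto.congr' ?_
  filter_upwards [self_mem_nhdsWithin, nhdsWithin_le_nhds (eventually_one_lt_norm hw)]
    with z him hz
  rw [hG.L_eq him.ne, hG.segmentCauchy_eq_of_im_neg him hz]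

theorem tendsto_gfun (hG : IsMonotoneProfile G) (x t : ℝ) {w : ℝ} (hw : w ∈ Ioo (endA G) (-1)) :
    Tendsto (gfun G x t) (𝓝[(PInf G)ᶜ] (w : ℂ))
      (𝓝 (rt w / (2 * Real.pi) * regularCauchy G w + (rt w)⁻¹ * ((t - x) / 2))) := by
  have hslit := neg_ofReal_mem_slitPlane (hw.2.trans neg_one_lt_zero)
  have hcont : ContinuousAt (fun z => rt z / (2 * Real.pi) * regularCauchy G z +
      (rt z)⁻¹ * ((t - x) / 2)) (w : ℂ) :=
    (((differentiableAt_rt hslit).continuousAt.div_const _).mul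
      (hG.continuousAt_regularCauchy hw.2)).add
      ((differentiableAt_inv_rt hslit).continuousAt.mul continuousAt_const)
  have hre : ∀ᶠ z : ℂ in 𝓝 (w : ℂ), z.re ∈ Ioo (endA G) (-1) :=
    continuous_re.continuousAt.eventually_mem (Ioo_mem_nhds hw.1 hw.2)
  refine hcont.continuousWithinAt.tendsto.congr' ?_
  filter_upwards [self_mem_nhdsWithin, nhdsWithin_le_nhds (eventually_one_lt_norm hw.2),
    nhdsWithin_le_nhds hre] with z hPInf hz hzre
  refine (hG.gfun_eq x t (fun him => hPInf (Or.inr ⟨z.re, ⟨hzre.1.le, ?_⟩, ?_⟩)) hz).symm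
  · linarith [hzre.2, hG.lt_endB]
  · exact Complex.ext rfl him.symm

theorem rt_mul_segmentBoundary_add (hG : IsMonotoneProfile G) {u : ℝ} (hu : 0 < u) {w : ℂ}
    (hw : w = (-Real.exp (2 * u) : ℝ)) :
    rt w / Real.pi * (segmentBoundary G (-1) w + segmentBoundary G 1 w) =
      (2 * Real.sinh u * xcrit G - ∫ s in (0 : ℝ)..xcrit G,
        √((2 * Real.sinh u) ^ 2 - (G s ^ 2 - 4)) : ℝ) := by
  have hcont := hG.continuous
  have hsinh : 0 < 2 * Real.sinh u := mul_pos two_pos (Real.sinh_pos_iff.2 hu)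
  have hfactor : rt w * ((1 + w) / w) = (2 * Real.sinh u : ℝ) := by
    have hexp : (Real.exp u : ℂ) ≠ 0 := ofReal_ne_zero.2 (Real.exp_pos u).ne'
    rw [hw, rt_neg_exp, two_mul u, Real.exp_add, Real.sinh_eq, Real.exp_neg]
    push_cast at hexp ⊢
    field_simp
    ring
  have hint (ε : ℝ) : IntervalIntegrable (fun s =>
      1 - signedRoot ε (1 - (G s ^ 2 - 4 : ℝ) / rootGap w ^ 2)) volume 0 (xcrit G) := by
    have hroot := continuous_signedRoot ε
    exact (by fun_prop : Continuous _).intervalIntegrable _ _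
  rw [segmentBoundary, segmentBoundary, ← mul_add,
    ← intervalIntegral.integral_add (hint _) (hint _)]
  simp_rw [show rootGap w = (2 * Real.sinh u : ℝ) from hw ▸ rootGap_neg_exp u,
    one_sub_signedRoot_add _ hsinh]
  generalize 2 * Real.sinh u = p at hfactor hsinh
  rw [intervalIntegral.integral_ofReal, intervalIntegral.integral_const_mul,
    intervalIntegral.integral_sub (by simp) ((by fun_prop : Continuous _).intervalIntegrable _ _),
    intervalIntegral.integral_const]
  have hpi : (Real.pi : ℂ) ≠ 0 := ofReal_ne_zero.2 Real.pi_ne_zero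
  have hp : (p : ℂ) ≠ 0 := ofReal_ne_zero.2 hsinh.ne'
  rw [smul_eq_mul, sub_zero]
  generalize ∫ s in (0 : ℝ)..xcrit G, √(p ^ 2 - (G s ^ 2 - 4)) = J
  push_cast
  rw [show rt w / Real.pi * (Real.pi / 2 * ((1 + w) / w) * (2 / p * (xcrit G * p - J))) =
    rt w * ((1 + w) / w) * (Real.pi / Real.pi) * ((xcrit G * p - J) / p) by ring, hfactor]
  field_simp

theorem isPhaseValue (hG : IsMonotoneProfile G) (x t : ℝ) {u : ℝ} (hu : u ∈ Ioo 0 (halfWidth G)) :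
    IsPhaseValue G x t (-Real.exp (2 * u))
      (-Real.sinh u * (x - xcrit G) - Real.cosh u * t - (∫ s in (0 : ℝ)..xcrit G,
        √((2 * Real.sinh u) ^ 2 - (G s ^ 2 - 4))) / 2 : ℝ) := by
  have hA : endA G < -Real.exp (2 * u) := by
    rw [hG.endA_eq, neg_lt_neg_iff, Real.exp_lt_exp]
    linarith [hu.2]
  have hlt : -Real.exp (2 * u) < -1 := by
    rw [neg_lt_neg_iff, Real.one_lt_exp_iff]
    linarith [hu.1]
  refine ⟨hA, hlt, _, _, _, hG.tendsto_L_im_pos hlt, hG.tendsto_L_im_neg hlt,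
    hG.tendsto_gfun x t ⟨hA, hlt⟩, ?_⟩
  have hmean := hG.rt_mul_segmentBoundary_add hu.1 rfl
  have hinv : (rt ((-Real.exp (2 * u) : ℝ) : ℂ))⁻¹ = Real.cosh u - Real.sinh u := by
    rw [rt_neg_exp, ← ofReal_inv, ← Real.exp_neg, ← Real.cosh_sub_sinh, ofReal_sub]
  rw [Q, E_neg_exp, D_eq, rootGap_neg_exp, hinv]
  generalize (∫ s in (0 : ℝ)..xcrit G, √((2 * Real.sinh u) ^ 2 - (G s ^ 2 - 4))) = J at *
  generalize ((-Real.exp (2 * u) : ℝ) : ℂ) = w at *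
  generalize Real.sinh u = S at *
  generalize Real.cosh u = C at *
  push_cast at hmean ⊢
  linear_combination (-1 / 2 : ℂ) * hmean - (C * x + S * t) * I_sq

end IsMonotoneProfile

/-! ### Analytic continuation -/

namespace IsMonotoneProfile

theorem integral_sqrt_sub_eq_zero (hG : IsMonotoneProfile G) {a p : ℝ} (ha : 0 ≤ a)
    (hp : G a ^ 2 - 4 = p) : ∫ s in (0 : ℝ)..a, √(p - (G s ^ 2 - 4)) = 0 := by
  rw [intervalIntegral.integral_congr (g := fun _ => 0), intervalIntegral.integral_zero]
  intro s hs
  rw [uIcc_of_le ha] at hs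
  refine Real.sqrt_eq_zero_of_nonpos ?_
  have hle := hG.strictMonoOn.monotoneOn hs.1 ha hs.2
  nlinarith [hG.neg ha]

theorem integral_sqrt_sub_eq_pow_three_mul (hG : IsMonotoneProfile G) {φ : ℝ → ℝ} {p : ℝ}
    (hp : 0 ≤ p) (hφ0 : φ 0 = xcrit G) (hφ : ∀ y ∈ Icc 0 (p ^ 2),
      AnalyticAt ℝ φ y ∧ 0 ≤ φ y ∧ G (φ y) ^ 2 - 4 = y) :
    ∫ s in (0 : ℝ)..xcrit G, √(p ^ 2 - (G s ^ 2 - 4)) =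
      p ^ 3 * ∫ τ in (0 : ℝ)..1, √(1 - τ) * -deriv φ (p ^ 2 * τ) := by
  have hcont := hG.continuous
  have hint : Continuous fun s => √(p ^ 2 - (G s ^ 2 - 4)) := by fun_prop
  obtain ⟨-, hφp, hGφp⟩ := hφ _ ⟨sq_nonneg p, le_rfl⟩
  rw [← intervalIntegral.integral_add_adjacent_intervals (hint.intervalIntegrable 0 (φ (p ^ 2)))
    (hint.intervalIntegrable _ _), hG.integral_sqrt_sub_eq_zero hφp hGφp, zero_add, ← hφ0]
  exact integral_sqrt_sub_eq_of_rightInverse hp (by fun_prop)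
    (fun y hy => (hφ y hy).1.differentiableAt.hasDerivAt)
    (fun y hy => (hφ y hy).1.deriv.continuousAt.continuousWithinAt) fun y hy => (hφ y hy).2.2

/-- On the scale of `p` the integrand lives in a neighborhood of `xcrit G` of size `p ^ 2`, where
`y = G ^ 2 - 4` is an analytic coordinate. -/
theorem exists_holomorphic_action (hG : IsMonotoneProfile G) (han : AnalyticAt ℝ G (xcrit G))
    (hderiv : deriv G (xcrit G) ≠ 0) :
    ∃ (H : ℂ → ℂ) (r : ℝ), 0 < r ∧ DifferentiableOn ℂ H (ball 0 r) ∧ H 0 = 2 * nu G ∧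
      ∀ p : ℝ, 0 ≤ p → p ^ 2 < r → ((∫ s in (0 : ℝ)..xcrit G,
        √(p ^ 2 - (G s ^ 2 - 4)) : ℝ) : ℂ) = p ^ 3 * H (p ^ 2) := by
  have hcrit := hG.apply_xcrit
  have hdY : deriv (fun s => G s ^ 2 - 4) (xcrit G) = -4 * deriv G (xcrit G) := by
    rw [((han.differentiableAt.hasDerivAt.fun_pow 2).sub_const 4).deriv, hcrit]
    ring
  obtain ⟨φ, hφan, hφ0, hφ', hφinv⟩ := exists_analyticAt_rightInverse
    (f := fun s => G s ^ 2 - 4) ((han.fun_pow 2).sub analyticAt_const)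
    (by rw [hdY]; exact mul_ne_zero (by norm_num) hderiv)
  rw [hdY] at hφ'
  simp only [hcrit, show (-2 : ℝ) ^ 2 - 4 = 0 by norm_num] at hφan hφ0 hφ' hφinv
  have hφpos : ∀ᶠ y in 𝓝 0, 0 < φ y :=
    hφan.continuousAt.eventually_const_lt (hφ0.symm ▸ hG.xcrit_pos)
  obtain ⟨δ, hδ, hlocal⟩ := Metric.eventually_nhds_iff_ball.1
    (hφan.eventually_analyticAt.and (hφpos.and hφinv))
  obtain ⟨H, ρ, hρ, hH, hHavg⟩ := exists_holomorphic_average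
    (k := fun τ => √(1 - τ)) (h := fun y => -deriv φ y)
    ((by fun_prop : Continuous _).intervalIntegrable _ _) hφan.deriv.neg
  refine ⟨H, min ρ δ, lt_min hρ hδ, hH.mono (ball_subset_ball (min_le_left _ _)), ?_, ?_⟩
  · rw [← Complex.ofReal_zero, hHavg 0 (by simpa using hρ)]
    simp only [zero_mul, intervalIntegral.integral_mul_const, integral_sqrt_one_sub, hφ', nu]
    push_cast
    field_simp
    norm_num
  · intro p hp hpr
    rw [hG.integral_sqrt_sub_eq_pow_three_mul hp hφ0 fun y hy => ?_]
    · rw [← Complex.ofReal_pow p 2, hHavg _ (by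
        rw [Real.norm_of_nonneg (sq_nonneg p)]; exact hpr.trans_le (min_le_left _ _))]
      push_cast
      rfl
    · obtain ⟨hanalytic, hpos, hinv⟩ := hlocal y (by
        rw [mem_ball_zero_iff, Real.norm_of_nonneg hy.1]
        exact hy.2.trans_lt (hpr.trans_le (min_le_right _ _)))
      exact ⟨hanalytic, hpos.le, hinv⟩

end IsMonotoneProfile

/-- The analytic continuation of `k(·; x, t)` in terms of `Δx = dx`. -/
noncomputable def phase (H : ℂ → ℂ) (dx t : ℝ) (w : ℂ) : ℂ :=
  2 * I * D w * dx + 2 * I * E w * t + cubicTerm H w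

theorem ofReal_mem_ball_neg_one {w ρ : ℝ} (hlower : -1 - ρ < w) (hupper : w < -1) :
    (w : ℂ) ∈ ball (-1) ρ := by
  rw [mem_ball_iff_norm, ← ofReal_one, ← ofReal_neg, ← ofReal_sub, norm_real,
    Real.norm_of_nonpos (by linarith)]
  linarith

theorem exists_ball_slitPlane_rootGap_sq (hG : IsMonotoneProfile G) {r : ℝ} (hr : 0 < r) :
    ∃ ρ > 0, ∀ w ∈ ball (-1 : ℂ) ρ,
      -w ∈ slitPlane ∧ rootGap w ^ 2 ∈ ball 0 r ∧ endA G < w.re := by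
  have hgap : ∀ᶠ w in 𝓝 (-1 : ℂ), rootGap w ^ 2 ∈ ball 0 r := by
    refine ((differentiableAt_rootGap eventually_neg_mem_slitPlane.self_of_nhds).pow
      2).continuousAt.eventually_mem (isOpen_ball.mem_nhds ?_)
    simpa [rootGap, rt_neg_one] using hr
  have hend : ∀ᶠ w in 𝓝 (-1 : ℂ), endA G < w.re :=
    continuous_re.continuousAt.eventually_const_lt (by simpa using hG.endA_lt)
  exact eventually_nhds_iff_ball.1 (eventually_neg_mem_slitPlane.and (hgap.and hend))

theorem IsMonotoneProfile.isPhaseValue_phase (hG : IsMonotoneProfile G) {H : ℂ → ℂ} {r : ℝ}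
    (hH : ∀ p : ℝ, 0 ≤ p → p ^ 2 < r →
      ((∫ s in (0 : ℝ)..xcrit G, √(p ^ 2 - (G s ^ 2 - 4)) : ℝ) : ℂ) = p ^ 3 * H (p ^ 2))
    (x t : ℝ) {w : ℝ} (hend : endA G < w) (hw : w < -1) (hgap : rootGap w ^ 2 ∈ ball 0 r) :
    IsPhaseValue G x t w (phase H (x - xcrit G) t w) := by
  obtain ⟨u, rfl⟩ : ∃ u : ℝ, -Real.exp (2 * u) = w := ⟨_, neg_exp_log_neg (by linarith)⟩
  have hu_pos : 0 < u := by
    simpa using hw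
  have hu_lt : u < halfWidth G := by
    simpa [hG.endA_eq] using hend
  have hrootGap : rootGap ↑(-Real.exp (2 * u)) = (2 * Real.sinh u : ℝ) := by
    simpa using rootGap_neg_exp u
  have hsmall : (2 * Real.sinh u) ^ 2 < r := by
    rwa [hrootGap, ← ofReal_pow, mem_ball_zero_iff, norm_real,
      Real.norm_of_nonneg (sq_nonneg _)] at hgap
  have hint := hH _ (mul_nonneg zero_le_two (Real.sinh_nonneg_iff.2 hu_pos.le)) hsmall
  convert hG.isPhaseValue (x := x) (t := t) ⟨hu_pos, hu_lt⟩ using 1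
  rw [phase, cubicTerm, D_eq, E_neg_exp, hrootGap, ← hint]
  push_cast
  linear_combination (Complex.sinh u * (x - xcrit G) + Complex.cosh u * t) * I_sq

theorem phase_sub_taylorPoly (H : ℂ → ℂ) (ν dx t : ℝ) (w : ℂ) :
    phase H dx t w - taylorPoly ν dx t (w + 1) =
      (2 * I * D w - (1 / 2 * (w + 1) + 1 / 4 * (w + 1) ^ 2 + 3 / 16 * (w + 1) ^ 3 +
        5 / 32 * (w + 1) ^ 4)) * dx +
      (2 * I * E w - (-1 - 1 / 8 * (w + 1) ^ 2 - 1 / 8 * (w + 1) ^ 3 -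
        15 / 128 * (w + 1) ^ 4)) * t +
      (cubicTerm H w - (ν * (w + 1) ^ 3 + 3 / 2 * ν * (w + 1) ^ 4)) := by
  rw [phase, taylorPoly]
  ring

theorem exists_norm_phase_sub_taylorPoly_le {H : ℂ → ℂ} {ν : ℝ} (hH : AnalyticAt ℂ H 0)
    (hH0 : H 0 = 2 * ν) (R : ℝ) :
    ∃ M δ : ℝ, 0 < δ ∧ ∀ dx t : ℝ, |dx| ≤ R → |t| ≤ R → ∀ w ∈ ball (-1 : ℂ) δ,
      ‖phase H dx t w - taylorPoly ν dx t (w + 1)‖ ≤ M * ‖w + 1‖ ^ 5 := by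
  obtain ⟨M, δ, hδ, hbound⟩ := exists_norm_affine_le_of_isBigO two_mul_I_mul_D_isBigO
    two_mul_I_mul_E_isBigO (cubicTerm_isBigO hH hH0) R
  refine ⟨M, δ, hδ, fun dx t hdx ht w hw => ?_⟩
  rw [phase_sub_taylorPoly, ← norm_pow]
  exact hbound dx t (by simpa using hdx) (by simpa using ht) w hw

end SineGordon

open SineGordon Metric in
theorem mainTheorem6_general (G : ℝ → ℝ) (hG : IsMonotoneProfile G)
    (han : AnalyticAt ℝ G (xcrit G)) (hderiv : 0 < deriv G (xcrit G)) :
    0 < xcrit G ∧ G (xcrit G) = -2 ∧ 0 < nu G ∧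
    ∃ (k : ℝ → ℝ → ℂ → ℂ) (ρ : ℝ), 0 < ρ ∧
      (∀ x t : ℝ, AnalyticOnNhd ℂ (k x t) (ball (-1) ρ)) ∧
      (∀ x t w : ℝ, -1 - ρ < w → w < -1 → IsPhaseValue G x t w (k x t w)) ∧
      (∃ α β γ : ℕ → ℂ, ∀ x t : ℝ, ∀ w ∈ ball (-1 : ℂ) ρ,
        HasSum (fun n : ℕ => (α n * ((x - xcrit G : ℝ) : ℂ) + β n * (t : ℂ) + γ n) *
          (w + 1) ^ n) (k x t w)) ∧
      (∀ R : ℝ, ∃ M δ : ℝ, 0 < δ ∧ ∀ x t : ℝ, |x - xcrit G| ≤ R → |t| ≤ R →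
        ∀ w ∈ ball (-1 : ℂ) δ,
          ‖k x t w - taylorPoly (nu G) (x - xcrit G) t (w + 1)‖ ≤ M * ‖w + 1‖ ^ 5) := by
  obtain ⟨H, r, hr, hH, hH0, haction⟩ := hG.exists_holomorphic_action han hderiv.ne'
  obtain ⟨ρ, hρ, hball⟩ := exists_ball_slitPlane_rootGap_sq hG hr
  have hD : DifferentiableOn ℂ (fun w => 2 * Complex.I * D w) (ball (-1) ρ) := fun w hw =>
    ((differentiableAt_D (hball w hw).1).const_mul _).differentiableWithinAt
  have hE : DifferentiableOn ℂ (fun w => 2 * Complex.I * E w) (ball (-1) ρ) := fun w hw =>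
    ((differentiableAt_E (hball w hw).1).const_mul _).differentiableWithinAt
  have hC : DifferentiableOn ℂ (cubicTerm H) (ball (-1) ρ) := fun w hw =>
    (differentiableAt_cubicTerm (hball w hw).1 (hH.differentiableAt
      (isOpen_ball.mem_nhds (hball w hw).2.1))).differentiableWithinAt
  refine ⟨hG.xcrit_pos, hG.apply_xcrit, by unfold nu; positivity,
    fun x => phase H (x - xcrit G), ρ, hρ, fun x t => ?_, fun x t w hρw hw => ?_, ?_, fun R => ?_⟩
  · exact (((hD.mul_const _).add (hE.mul_const _)).add hC).analyticOnNhd isOpen_ball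
  · obtain ⟨-, hgap, hend⟩ := hball w (ofReal_mem_ball_neg_one hρw hw)
    exact hG.isPhaseValue_phase haction x t hend hw hgap
  · obtain ⟨α, β, γ, hsum⟩ := exists_hasSum_affine_taylor hD hE hC
    exact ⟨α, β, γ, fun x t w hw => by
      simpa only [phase, sub_neg_eq_add] using hsum (x - xcrit G : ℝ) t w hw⟩
  · obtain ⟨M, δ, hδ, hbound⟩ := exists_norm_phase_sub_taylorPoly_le
      (hH.analyticAt (ball_mem_nhds 0 hr)) hH0 R
    exact ⟨M, δ, hδ, fun x t => hbound (x - xcrit G) t⟩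

/-- The phase function `k(·; x, t)`, given for real `w < -1` by its boundary-value formula,
continues to an analytic function near `w = -1` with the stated Taylor expansion; all Taylor
coefficients are (affine) linear in `Δx` and `t`, and the error term is uniform for bounded
`Δx` and `t`. -/
theorem mainTheorem6 (G : ℝ → ℝ) (hG : SineGordon.IsImpulseProfile G) :
    0 < SineGordon.xcrit G ∧ G (SineGordon.xcrit G) = -2 ∧ 0 < SineGordon.nu G ∧
    ∃ (k : ℝ → ℝ → ℂ → ℂ) (ρ : ℝ), 0 < ρ ∧
      (∀ x t : ℝ, AnalyticOnNhd ℂ (k x t) (Metric.ball (-1) ρ)) ∧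
      (∀ x t w : ℝ, -1 - ρ < w → w < -1 → SineGordon.IsPhaseValue G x t w (k x t w)) ∧
      (∃ α β γ : ℕ → ℂ, ∀ x t : ℝ, ∀ w ∈ Metric.ball (-1 : ℂ) ρ,
        HasSum (fun n : ℕ => (α n * ((x - SineGordon.xcrit G : ℝ) : ℂ) + β n * (t : ℂ) + γ n) *
          (w + 1) ^ n) (k x t w)) ∧
      (∀ R : ℝ, ∃ M δ : ℝ, 0 < δ ∧ ∀ x t : ℝ, |x - SineGordon.xcrit G| ≤ R → |t| ≤ R →
        ∀ w ∈ Metric.ball (-1 : ℂ) δ,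
          ‖k x t w - SineGordon.taylorPoly (SineGordon.nu G) (x - SineGordon.xcrit G) t (w + 1)‖
            ≤ M * ‖w + 1‖ ^ 5) :=
  mainTheorem6_general G hG.isMonotoneProfile (hG.analytic _ hG.isMonotoneProfile.xcrit_pos)
    (hG.deriv_pos _ hG.isMonotoneProfile.xcrit_pos)
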